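/- Let $d\ge 3$ and $n\ge d+1$ be integers, and let $\mathcal P_{d,n}$ be the set of $d$-dimensional convex polytopes in $\mathbb R^d$ with exactly $n$ vertices. For a polytope $P\subset\mathbb R^d$, let $\nu(P)$ be the maximum number of vertices of a slice $H\cap P$, where $H$ ranges over all affine hyperplanes of $\mathbb R^d$ with $H\cap P\neq\emptyset$ (for $P\in\mathcal P_{d,n}$ this maximum exists). For $t_1<t_2<\dots<t_n$ in $\mathbb R$, let the cyclic polytope $C_d(n)$ be the convex hull of the points $\gamma(t_1),\dots,\gamma(t_n)$, where $\gamma(t)=(t,t^2,\dots,t^d)$. Then, for every choice of $t_1<\dots<t_n$, the polytope $C_d(n)$ belongs to $\mathcal P_{d,n}$ and \[ \max_{P\in\mathcal P_{d,n}}\nu(P)=\nu(C_d(n))=\begin{cases}2(n-2) & \text{if } d=3,\\ \lfloor n/2\rfloor\,\lceil n/2\rceil & \text{if } d>3.\end{cases} \] -/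

import Mathlib

namespace PolytopeSlice

/-- A (convex) polytope in `ℝ^d`: the convex hull of a finite set of points. -/
def IsPolytope {d : ℕ} (P : Set (EuclideanSpace ℝ (Fin d))) : Prop :=
  ∃ S : Set (EuclideanSpace ℝ (Fin d)), S.Finite ∧ P = convexHull ℝ S

/-- The vertex set `V(P)`: the extreme points of `P`. -/
def vertexSet {d : ℕ} (P : Set (EuclideanSpace ℝ (Fin d))) : Set (EuclideanSpace ℝ (Fin d)) :=
  P.extremePoints ℝ

/-- The polytopes in `ℝ^d` of dimension `d` with exactly `n` vertices. The dimension is that of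
the affine hull. -/
def polytopes (d n : ℕ) : Set (Set (EuclideanSpace ℝ (Fin d))) :=
  {P | IsPolytope P ∧ Module.finrank ℝ (vectorSpan ℝ P) = d ∧ (vertexSet P).encard = n}

/-- Affine hyperplanes of `ℝ^d`. -/
def IsHyperplane {d : ℕ} (H : Set (EuclideanSpace ℝ (Fin d))) : Prop :=
  ∃ (a : EuclideanSpace ℝ (Fin d)) (b : ℝ), a ≠ 0 ∧ H = {x | inner ℝ a x = b}

/-- The set of hyperplanes that meet `P`. -/
def slicingHyperplanes {d : ℕ} (P : Set (EuclideanSpace ℝ (Fin d))) :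
    Set (Set (EuclideanSpace ℝ (Fin d))) :=
  {H | IsHyperplane H ∧ (H ∩ P).Nonempty}

/-- The number of vertices of the slice `H ∩ P`, as an extended natural number. -/
noncomputable def sliceVertexCount {d : ℕ} (P H : Set (EuclideanSpace ℝ (Fin d))) : ℕ∞ :=
  (vertexSet (H ∩ P)).encard

/-- `ν(P)`: the maximum number of vertices of a slice of `P`. As the supremum is taken in `ℕ∞`,
it is attained as soon as it is finite and `P` has a slice. -/
noncomputable def nu {d : ℕ} (P : Set (EuclideanSpace ℝ (Fin d))) : ℕ∞ :=
  sSup (sliceVertexCount P '' slicingHyperplanes P)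

/-- The moment curve `s ↦ (s, s², …, s^d)` in `ℝ^d`. -/
noncomputable def momentCurve (d : ℕ) (s : ℝ) : EuclideanSpace ℝ (Fin d) :=
  WithLp.toLp 2 (fun i : Fin d => s ^ ((i : ℕ) + 1))

/-- The cyclic polytope in `ℝ^d` with parameters `t` (used for `t 0 < t 1 < ⋯ < t (n - 1)`). -/
noncomputable def cyclicPolytope (d : ℕ) {n : ℕ} (t : Fin n → ℝ) :
    Set (EuclideanSpace ℝ (Fin d)) :=
  convexHull ℝ (Set.range fun i => momentCurve d (t i))

/-- `2(n-2)` in dimension `3`, and `⌊n/2⌋⌈n/2⌉` in the other dimensions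
(here used for `d > 3`). -/
noncomputable def maxSliceVertices (d n : ℕ) : ℕ :=
  if d = 3 then 2 * (n - 2) else ⌊(n : ℝ) / 2⌋₊ * ⌈(n : ℝ) / 2⌉₊

end PolytopeSlice

/-!
Let `H` be a hyperplane with `k` vertices of the polytope `P` on it, `p` above and `q` below. A
vertex of `H ∩ P` that is not a vertex of `P` lies inside a segment from an upper vertex `a` to a
lower vertex `b`: otherwise `P` would contain, around this point, segments in two independent
directions, and a combination of the two would lie in `H`
(`mem_or_exists_openSegment_of_mem_extremePoints`). The pair `(a, b)` determines the vertex, so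
there are at most `k + p q` vertices, which is at most `⌊n/2⌋⌈n/2⌉` since `n ≥ 4` and not all
vertices lie on `H`.

In dimension three the slice is a polygon. List its vertices that are not vertices of `P` in cyclic
order (`exists_counterclockwise`). The sequence of upper endpoints has no interlacing pattern `a …
a' … a … a'`. Indeed, for slice vertices `x, y` on edges from `a`, the plane through `a, x, y` cuts
the part of `P` above `H` in exactly the triangle `a x y`, because two of its sides lie on edges of
`P` and the third on `H`. An edge from `a'` to a point of `H` on the other side of the plane would
have to pass through this triangle (`eq_of_orient_mul_nonpos`). A cyclic sequence without
interlacing and with `p` values changes at most `2 (p - 1)` times (`card_changes_le`). At every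
step around the list, if it has at least two members, the upper or the lower endpoint changes,
which leaves at most `2 (p - 1) + 2 (q - 1)` such vertices (`card_le_of_planar_slice`), hence at
most `2 (n - 2)` vertices in all.

For the cyclic polytope, polynomials of degree at most `d` are affine functionals restricted to the
moment curve. Nonnegative polynomials vanishing at exactly two of the parameters exhibit edges: `(X
- tᵢ)² (X - tⱼ)²` for all pairs if `d ≥ 4`, and `(X - t₁) (X - tⱼ)²`, `(tₙ - X) (X - tⱼ)²` for `d =
3`. Each edge crossing a hyperplane gives its own vertex of the slice
(`card_mul_card_le_encard_extremePoints`). For `d ≥ 4` take a hyperplane halving the vertices; for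
`d = 3` take one separating the first and the last vertex from the others.
-/

namespace PolytopeSlice

/-! ### Vertices of hyperplane slices -/

section Convexity

variable {E : Type*} [AddCommGroup E] [Module ℝ E]

/-- `P` contains a segment in direction `v` with `x` in its interior (or `v = 0` and `x ∈ P`). -/
def TwoSided (P : Set E) (x v : E) : Prop :=
  ∃ ε : ℝ, 0 < ε ∧ x + ε • v ∈ P ∧ x - ε • v ∈ P

variable {P : Set E} {x y z u v w a b : E} {φ : E →ₗ[ℝ] ℝ} {c : ℝ}

lemma TwoSided.smul (h : TwoSided P x v) {r : ℝ} (hr : r ≠ 0) : TwoSided P x (r • v) := by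
  obtain ⟨ε, h0, h1, h2⟩ := h
  rcases lt_or_gt_of_ne hr with hr' | hr'
  · refine ⟨ε / -r, div_pos h0 (by linarith), ?_, ?_⟩
    · rw [smul_smul, show ε / -r * r = -ε by field_simp, neg_smul, ← sub_eq_add_neg]
      exact h2
    · rw [smul_smul, show ε / -r * r = -ε by field_simp, neg_smul, sub_neg_eq_add]
      exact h1
  · refine ⟨ε / r, div_pos h0 hr', ?_, ?_⟩
    · rwa [smul_smul, div_mul_cancel₀ _ hr]
    · rwa [smul_smul, div_mul_cancel₀ _ hr]

lemma twoSided_of_mem_openSegment (hP : Convex ℝ P) (ha : a ∈ P) (hb : b ∈ P)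
    (hx : x ∈ openSegment ℝ a b) : TwoSided P x (b - a) := by
  obtain ⟨s, t, hs, ht, hst, rfl⟩ := hx
  have hm : 0 < min s t := lt_min hs ht
  refine ⟨min s t, hm, ?_, ?_⟩
  · have := hP ha hb (a := s - min s t) (b := t + min s t)
      (by linarith [min_le_left s t]) (by linarith) (by linarith)
    convert this using 1
    module
  · have := hP ha hb (a := s + min s t) (b := t - min s t)
      (by linarith) (by linarith [min_le_right s t]) (by linarith)
    convert this using 1
    module

/-- A two-sided direction at an endpoint `y` of a segment in `P` stays two-sided in the interior of
the segment. -/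
lemma TwoSided.of_mem_openSegment (hP : Convex ℝ P) (h : TwoSided P y v) (hz : z ∈ P)
    (hx : x ∈ openSegment ℝ y z) : TwoSided P x v := by
  obtain ⟨ε, h0, h1, h2⟩ := h
  obtain ⟨s, t, hs, ht, hst, rfl⟩ := hx
  refine ⟨s * ε, mul_pos hs h0, ?_, ?_⟩
  · have := hP h1 hz hs.le ht.le hst
    convert this using 1
    module
  · have := hP h2 hz hs.le ht.le hst
    convert this using 1
    module

lemma twoSided_add (hP : Convex ℝ P) (hu : TwoSided P x u) (hv : TwoSided P x v) :
    TwoSided P x (u + v) := by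
  obtain ⟨ε, h0, h1, h2⟩ := hu
  obtain ⟨δ, k0, k1, k2⟩ := hv
  have hs : 0 < ε + δ := by linarith
  have e1 : 0 ≤ δ / (ε + δ) := by positivity
  have e2 : 0 ≤ ε / (ε + δ) := by positivity
  have e3 : δ / (ε + δ) + ε / (ε + δ) = 1 := by field_simp; ring
  refine ⟨ε * δ / (ε + δ), by positivity, ?_, ?_⟩
  · have := hP h1 k1 e1 e2 e3
    convert this using 1
    match_scalars <;> field_simp <;> ring
  · have := hP h2 k2 e1 e2 e3
    convert this using 1
    match_scalars <;> field_simp <;> ring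

/-- At an extreme point of a hyperplane slice, the two-sided directions of the whole convex set
that leave the hyperplane span at most a line: a second such direction could be corrected to
one inside the hyperplane. -/
lemma exists_eq_smul_of_twoSided (hP : Convex ℝ P)
    (hx : x ∈ ({y | φ y = c} ∩ P).extremePoints ℝ) (hφu : φ u ≠ 0)
    (hu : TwoSided P x u) (hv : TwoSided P x v) : ∃ τ : ℝ, v = τ • u := by
  by_cases hφv : φ v = 0
  · -- then `v` itself lies in the hyperplane direction
    refine ⟨0, ?_⟩
    obtain ⟨ε, h0, h1, h2⟩ := hv
    have hxc : φ x = c := hx.1.1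
    have := hx.2 ⟨show φ _ = c by simp [hφv, hxc], h1⟩ ⟨show φ _ = c by simp [hφv, hxc], h2⟩
      ⟨1/2, 1/2, by norm_num, by norm_num, by norm_num, by module⟩
    have h3 : ε • v = 0 := by simpa using this
    rw [zero_smul]
    exact (smul_eq_zero.1 h3).resolve_left h0.ne'
  · refine ⟨φ v / φ u, ?_⟩
    have hτ : -(φ v / φ u) ≠ 0 := by
      simp [hφu, hφv]
    obtain ⟨ε, h0, h1, h2⟩ := twoSided_add hP (hu.smul hτ) hv
    have hxc : φ x = c := hx.1.1
    have h4 : φ (-(φ v / φ u) • u + v) = 0 := by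
      simp [hφu]
    have := hx.2 ⟨show φ _ = c by rw [map_add, map_smul, h4]; simp [hxc], h1⟩
      ⟨show φ _ = c by rw [map_sub, map_smul, h4]; simp [hxc], h2⟩
      ⟨1/2, 1/2, by norm_num, by norm_num, by norm_num, by module⟩
    have h3 : ε • (-(φ v / φ u) • u + v) = 0 := by simpa using this
    have h5 := (smul_eq_zero.1 h3).resolve_left h0.ne'
    rw [neg_smul, neg_add_eq_zero] at h5
    exact h5.symm

/-- If an extreme point of a hyperplane slice lies inside the segment `[a, b]` crossing the
hyperplane, then `[a, b]` behaves as an edge: segments of `P` meeting its interior are parallel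
to it. -/
lemma exists_eq_smul_of_mem_openSegment (hP : Convex ℝ P)
    (hx : x ∈ ({y | φ y = c} ∩ P).extremePoints ℝ) (ha : a ∈ P) (hb : b ∈ P) (hab : φ a ≠ φ b)
    (hxab : x ∈ openSegment ℝ a b) (hy : y ∈ openSegment ℝ a b) (hz : z ∈ P) (hw : w ∈ P)
    (hyzw : y ∈ openSegment ℝ z w) : ∃ τ : ℝ, w - z = τ • (b - a) := by
  have hv := twoSided_of_mem_openSegment hP hz hw hyzw
  refine exists_eq_smul_of_twoSided hP hx (by rw [map_sub]; exact sub_ne_zero.2 hab.symm)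
    (twoSided_of_mem_openSegment hP ha hb hxab) ?_
  obtain ⟨s, t, hs, ht, hst, rfl⟩ := hxab
  obtain ⟨s', t', hs', ht', hst', rfl⟩ := hy
  rcases lt_trichotomy t t' with h | h | h
  · refine hv.of_mem_openSegment hP ha ⟨t / t', 1 - t / t', by positivity, ?_, by ring, ?_⟩
    · rw [sub_pos, div_lt_one ht']; exact h
    · obtain rfl : s' = 1 - t' := by linarith
      obtain rfl : s = 1 - t := by linarith
      match_scalars <;> field_simp
      ring
  · obtain rfl : s' = 1 - t' := by linarith
    obtain rfl : s = 1 - t := by linarith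
    rwa [h]
  · refine hv.of_mem_openSegment hP hb ⟨s / s', 1 - s / s', by positivity, ?_, by ring, ?_⟩
    · rw [sub_pos, div_lt_one hs']; linarith
    · obtain rfl : t' = 1 - s' := by linarith
      obtain rfl : t = 1 - s := by linarith
      match_scalars <;> field_simp
      ring

/-- A line transversal to a hyperplane meets it in one point. -/
lemma eq_of_eq_add_smul (hab : φ u ≠ 0) {r : ℝ} (h : y = x + r • u) (hxy : φ x = φ y) :
    y = x := by
  rw [h, map_add, map_smul, smul_eq_mul] at hxy
  have : r = 0 := by
    rcases mul_eq_zero.1 (show r * φ u = 0 by linarith) with h | h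
    · exact h
    · exact absurd h hab
  rw [h, this]; simp

lemma exists_eq_add_smul_of_mem_openSegment (hx : x ∈ openSegment ℝ a b)
    (hy : y ∈ openSegment ℝ a b) : ∃ r : ℝ, y = x + r • (b - a) := by
  obtain ⟨s, t, hs, ht, hst, rfl⟩ := hx
  obtain ⟨s', t', hs', ht', hst', rfl⟩ := hy
  refine ⟨t' - t, ?_⟩
  obtain rfl : s' = 1 - t' := by linarith
  obtain rfl : s = 1 - t := by linarith
  module

lemma eq_of_mem_openSegment (hab : φ a ≠ φ b) (hx : x ∈ openSegment ℝ a b)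
    (hy : y ∈ openSegment ℝ a b) (hxy : φ x = φ y) : x = y := by
  obtain ⟨r, hr⟩ := exists_eq_add_smul_of_mem_openSegment hx hy
  exact (eq_of_eq_add_smul (by rw [map_sub]; exact sub_ne_zero.2 hab.symm) hr hxy).symm

/-- A vertex of a hyperplane slice of a polytope is a vertex of the polytope or is interior to a
segment between vertices on the two sides of the hyperplane. -/
lemma mem_or_exists_openSegment_of_mem_extremePoints (V : Finset E)
    (hx : x ∈ ({y | φ y = c} ∩ convexHull ℝ (V : Set E)).extremePoints ℝ) :
    x ∈ V ∨ ∃ a ∈ V, ∃ b ∈ V, c < φ a ∧ φ b < c ∧ x ∈ openSegment ℝ a b := by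
  classical
  have hP := convex_convexHull ℝ (V : Set E)
  have hVP : ∀ v ∈ V, v ∈ convexHull ℝ (V : Set E) := fun v hv => subset_convexHull ℝ _ hv
  have hxc : φ x = c := hx.1.1
  obtain ⟨wt, h0, h1, hsum⟩ := (Finset.mem_convexHull'.1 hx.1.2)
  by_cases hxV : x ∈ V
  · exact Or.inl hxV
  right
  -- differences of vertices of positive weight are two-sided directions
  have key : ∀ p ∈ V, ∀ q ∈ V, 0 < wt p → 0 < wt q →
      TwoSided (convexHull ℝ (V : Set E)) x (q - p) := by
    have aux : ∀ p ∈ V, ∀ q ∈ V, ∀ ε : ℝ, 0 < ε → ε ≤ wt p →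
        x + ε • (q - p) ∈ convexHull ℝ (V : Set E) := by
      intro p hp q hq ε hε hεp
      refine Finset.mem_convexHull'.2 ⟨fun v => wt v + (if v = q then ε else 0) -
        (if v = p then ε else 0), ?_, ?_, ?_⟩
      · intro v hv
        have := h0 v hv
        dsimp only
        split_ifs with h1 h2 h2
        · linarith
        · linarith
        · subst h2; linarith
        · linarith
      · simp [Finset.sum_add_distrib, Finset.sum_sub_distrib, hp, hq, h1]
      · simp only [sub_smul, add_smul, Finset.sum_sub_distrib, Finset.sum_add_distrib, hsum,
          ite_smul, zero_smul, Finset.sum_ite_eq', hp, hq, if_true]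
        module
    intro p hp q hq hwp hwq
    refine ⟨min (wt p) (wt q), lt_min hwp hwq,
      aux p hp q hq _ (lt_min hwp hwq) (min_le_left _ _), ?_⟩
    have := aux q hq p hp _ (lt_min hwp hwq) (min_le_right _ _)
    convert this using 1
    module
  have hφsum : ∑ v ∈ V, wt v * (φ v - c) = 0 := by
    have h2 := congrArg φ hsum
    simp only [map_sum, map_smul, smul_eq_mul] at h2
    simp only [mul_sub, Finset.sum_sub_distrib, ← Finset.sum_mul, h1, h2, hxc]
    ring
  -- no vertex of positive weight lies in the hyperplane, or `x` would be that vertex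
  have hne : ∀ v ∈ V, 0 < wt v → φ v ≠ c := by
    intro v hv hwv hvc
    have hall : ∀ q ∈ V, 0 < wt q → φ q = c → q = v := by
      intro q hq hwq hqc
      obtain ⟨ε, e0, e1, e2⟩ := key v hv q hq hwv hwq
      have := hx.2 ⟨show φ _ = c by simp [hxc, hqc, hvc], e1⟩
        ⟨show φ _ = c by simp [hxc, hqc, hvc], e2⟩
        ⟨1/2, 1/2, by norm_num, by norm_num, by norm_num, by module⟩
      have h3 : ε • (q - v) = 0 := by simpa using this
      exact sub_eq_zero.1 ((smul_eq_zero.1 h3).resolve_left e0.ne')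
    apply hxV
    by_cases hex : ∃ q ∈ V, 0 < wt q ∧ φ q ≠ c
    · obtain ⟨q, hq, hwq, hqc⟩ := hex
      -- all weight lies on the line `v q`, which meets the hyperplane in `v`
      have hline : ∀ r ∈ V, ∃ τ : ℝ, wt r • (r - v) = τ • (q - v) := by
        intro r hr
        rcases (h0 r hr).eq_or_lt with h | h
        · exact ⟨0, by simp [← h]⟩
        · obtain ⟨τ, hτ⟩ := exists_eq_smul_of_twoSided hP hx
            (u := q - v) (by simp [sub_eq_zero, hvc, hqc]) (key v hv q hq hwv hwq)
            (key v hv r hr hwv h)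
          exact ⟨wt r * τ, by rw [hτ, smul_smul]⟩
      choose! τ hτ using hline
      have hxv : x = v + (∑ r ∈ V, τ r) • (q - v) := by
        rw [Finset.sum_smul, ← Finset.sum_congr rfl hτ]
        simp only [smul_sub, Finset.sum_sub_distrib, ← Finset.sum_smul, h1, hsum]
        module
      rw [eq_of_eq_add_smul (φ := φ) (by simp [sub_eq_zero, hvc, hqc]) hxv (hvc.trans hxc.symm)]
      exact hv
    · push Not at hex
      have : x = v := by
        rw [← hsum]
        calc ∑ r ∈ V, wt r • r = ∑ r ∈ V, wt r • v := by
              refine Finset.sum_congr rfl fun r hr => ?_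
              rcases (h0 r hr).eq_or_lt with h | h
              · simp [← h]
              · rw [hall r hr h (hex r hr h)]
          _ = v := by rw [← Finset.sum_smul, h1, one_smul]
      rw [this]; exact hv
  obtain ⟨v₀, hv₀, hwv₀⟩ : ∃ v ∈ V, 0 < wt v := by
    by_contra hcon
    push Not at hcon
    have : ∑ v ∈ V, wt v ≤ 0 := Finset.sum_nonpos hcon
    linarith
  have hpos : ∃ a ∈ V, 0 < wt a ∧ c < φ a := by
    by_contra hcon
    push Not at hcon
    have : ∑ v ∈ V, wt v * (φ v - c) < 0 := by
      refine Finset.sum_neg' (fun v hv => ?_) ⟨v₀, hv₀, ?_⟩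
      · rcases (h0 v hv).eq_or_lt with h | h
        · simp [← h]
        · exact mul_nonpos_of_nonneg_of_nonpos h.le (by linarith [hcon v hv h])
      · exact mul_neg_of_pos_of_neg hwv₀
          (by linarith [lt_of_le_of_ne (hcon v₀ hv₀ hwv₀) (hne v₀ hv₀ hwv₀)])
    linarith
  have hneg : ∃ b ∈ V, 0 < wt b ∧ φ b < c := by
    by_contra hcon
    push Not at hcon
    have : 0 < ∑ v ∈ V, wt v * (φ v - c) := by
      refine Finset.sum_pos' (fun v hv => ?_) ⟨v₀, hv₀, ?_⟩
      · rcases (h0 v hv).eq_or_lt with h | h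
        · simp [← h]
        · exact mul_nonneg h.le (by linarith [hcon v hv h])
      · exact mul_pos hwv₀
          (by linarith [lt_of_le_of_ne (hcon v₀ hv₀ hwv₀) (hne v₀ hv₀ hwv₀).symm])
    linarith
  obtain ⟨a, ha, hwa, hac⟩ := hpos
  obtain ⟨b, hb, hwb, hbc⟩ := hneg
  refine ⟨a, ha, b, hb, hac, hbc, ?_⟩
  have hφ : φ (b - a) ≠ 0 := by rw [map_sub]; linarith
  have hline : ∀ r ∈ V, ∃ τ : ℝ, wt r • (r - a) = τ • (b - a) := by
    intro r hr
    rcases (h0 r hr).eq_or_lt with h | h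
    · exact ⟨0, by simp [← h]⟩
    · obtain ⟨τ, hτ⟩ := exists_eq_smul_of_twoSided hP hx hφ (key a ha b hb hwa hwb)
        (key a ha r hr hwa h)
      exact ⟨wt r * τ, by rw [hτ, smul_smul]⟩
  choose! τ hτ using hline
  have hxv : x = a + (∑ r ∈ V, τ r) • (b - a) := by
    rw [Finset.sum_smul, ← Finset.sum_congr rfl hτ]
    simp only [smul_sub, Finset.sum_sub_distrib, ← Finset.sum_smul, h1, hsum]
    module
  set T := ∑ r ∈ V, τ r
  have hT : φ a + T * (φ b - φ a) = c := by
    rw [← hxc]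
    conv_rhs => rw [hxv]
    simp
  refine ⟨1 - T, T, ?_, ?_, by ring, by rw [hxv]; module⟩
  · by_contra hcon
    nlinarith
  · by_contra hcon
    nlinarith

end Convexity

/-! ### Edges at distinct vertices do not interlace around a planar slice -/

section Noncrossing

variable {E : Type*} [AddCommGroup E] [Module ℝ E]

/-- Twice the signed area of the triangle `x y z`, in the coordinates `g₁, g₂`. -/
def orient (g₁ g₂ : E →ₗ[ℝ] ℝ) (x y z : E) : ℝ :=
  (g₁ y - g₁ x) * (g₂ z - g₂ x) - (g₂ y - g₂ x) * (g₁ z - g₁ x)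

variable {P : Set E} {φ g₁ g₂ : E →ₗ[ℝ] ℝ} {c : ℝ} {x y p a a' bx b_y bp w : E}

lemma mem_openSegment_of_mem_openSegment {q b : E} (hy : y ∈ openSegment ℝ a b)
    (hq : q ∈ openSegment ℝ a y) : q ∈ openSegment ℝ a b := by
  obtain ⟨s, t, hs, ht, hst, rfl⟩ := hy
  obtain ⟨s', t', hs', ht', hst', rfl⟩ := hq
  refine ⟨s' + t' * s, t' * t, by positivity, by positivity, ?_, by module⟩
  linear_combination hst' + t' * hst

/-- The plane through the vertex `a` and the slice vertices `x, y` on edges at `a` cuts the cap of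
`P` beyond the hyperplane in the triangle `a x y`: a point `w` of the cap in this plane has a
nonnegative barycentric coordinate at `x` (and at `y`, by symmetry). -/
lemma barycentric_nonneg (hP : Convex ℝ P) (ha : a ∈ P.extremePoints ℝ) (hac : c < φ a)
    (hx : x ∈ ({v | φ v = c} ∩ P).extremePoints ℝ)
    (hy : y ∈ ({v | φ v = c} ∩ P).extremePoints ℝ) (hxy : x ≠ y)
    (hbP : b_y ∈ P) (hbc : φ b_y < c) (hyb : y ∈ openSegment ℝ a b_y) (hw : w ∈ P)
    {α β γ : ℝ} (hα : 0 < α) (hsum : α + β + γ = 1) (hwe : w = α • a + β • x + γ • y) :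
    0 ≤ β := by
  by_contra hβ
  push Not at hβ
  have hxc : φ x = c := hx.1.1
  have hyc : φ y = c := hy.1.1
  rcases lt_or_ge 0 γ with hγ | hγ
  · have hαγ : 0 < α + γ := by linarith
    have hq : (α / (α + γ)) • a + (γ / (α + γ)) • y ∈ openSegment ℝ a y :=
      ⟨_, _, by positivity, by positivity, by field_simp, rfl⟩
    have hqb := mem_openSegment_of_mem_openSegment hyb hq
    have hqw : (α / (α + γ)) • a + (γ / (α + γ)) • y ∈ openSegment ℝ w x := by
      refine ⟨1 / (α + γ), -β / (α + γ), by positivity, div_pos (by linarith) hαγ, ?_, ?_⟩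
      · field_simp; linarith
      · rw [hwe]; match_scalars <;> field_simp
        ring
    obtain ⟨τ, hτ⟩ := exists_eq_smul_of_mem_openSegment hP hy ha.1 hbP (by linarith) hyb hqb hw
      hx.1.2 hqw
    obtain ⟨r, hr⟩ := exists_eq_add_smul_of_mem_openSegment hyb hqb
    have hxe : x = y + (r + τ / (α + γ)) • (b_y - a) := by
      have h1 : x = ((α / (α + γ)) • a + (γ / (α + γ)) • y) + (1 / (α + γ)) • (x - w) := by
        obtain rfl : β = 1 - (α + γ) := by linarith
        rw [hwe]
        match_scalars <;> field_simp <;> ring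
      rw [h1, hτ, hr]
      module
    exact hxy (eq_of_eq_add_smul (φ := φ) (by rw [map_sub]; linarith) hxe (hyc.trans hxc.symm))
  · have hβγ : 0 < -β - γ := by linarith
    have hq : (-β / (-β - γ)) • x + (-γ / (-β - γ)) • y ∈ P :=
      hP hx.1.2 hy.1.2 (by apply div_nonneg <;> linarith) (by apply div_nonneg <;> linarith)
        (by field_simp; ring)
    have hmem : a ∈ openSegment ℝ ((-β / (-β - γ)) • x + (-γ / (-β - γ)) • y) w := by
      refine ⟨(-β - γ) / α, 1 / α, by positivity, by positivity, ?_, ?_⟩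
      · field_simp; linarith
      · rw [hwe]; match_scalars <;> field_simp <;> ring
    have h1 := ha.2 hq hw hmem
    have h2 := congrArg φ h1
    rw [map_add, map_smul, map_smul, hxc, hyc, ← add_smul, ← add_div,
      show (-β + -γ) / (-β - γ) = 1 by rw [div_eq_one_iff_eq hβγ.ne']; ring, one_smul] at h2
    linarith

/-- The crossing point `w` of the segment `[a', p]` with the plane through `a, x, y` lies in the
triangle `a x y`; this forces `a' = a` since `[a', bp]` behaves as an edge of `P`. -/
lemma eq_of_orient_mul_nonpos (hinj : ∀ v, φ v = 0 → g₁ v = 0 → g₂ v = 0 → v = 0)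
    (hP : Convex ℝ P) (ha : a ∈ P.extremePoints ℝ) (ha' : a' ∈ P.extremePoints ℝ)
    (hac : c < φ a) (hac' : c < φ a')
    (hx : x ∈ ({v | φ v = c} ∩ P).extremePoints ℝ) (hy : y ∈ ({v | φ v = c} ∩ P).extremePoints ℝ)
    (hp : p ∈ ({v | φ v = c} ∩ P).extremePoints ℝ)
    (hbx : bx ∈ P) (hbxc : φ bx < c) (hxb : x ∈ openSegment ℝ a bx)
    (hby : b_y ∈ P) (hbyc : φ b_y < c) (hyb : y ∈ openSegment ℝ a b_y)
    (hbp : bp ∈ P) (hbpc : φ bp < c) (hpb : p ∈ openSegment ℝ a' bp)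
    (hne : orient g₁ g₂ x y p ≠ 0)
    (hsep : (orient g₁ g₂ x y a' * (φ a - c) - orient g₁ g₂ x y a * (φ a' - c)) *
      orient g₁ g₂ x y p ≤ 0) : a = a' := by
  have hxc : φ x = c := hx.1.1
  have hyc : φ y = c := hy.1.1
  have hpc : φ p = c := hp.1.1
  have hxy : x ≠ y := by rintro rfl; simp [orient] at hne
  have hxp : x ≠ p := by rintro rfl; simp [orient] at hne
  have hyp : y ≠ p := by
    rintro rfl; apply hne; simp only [orient]; ring
  -- the values at `a'` and `p` of a multiple of the affine function vanishing on the plane `a x y`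
  set A := orient g₁ g₂ x y a' * (φ a - c) - orient g₁ g₂ x y a * (φ a' - c) with hA
  set B := orient g₁ g₂ x y p * (φ a - c) with hB
  have hB0 : B ≠ 0 := mul_ne_zero hne (by linarith)
  have hAB : A * B ≤ 0 := by
    rw [hB, ← mul_assoc]; exact mul_nonpos_of_nonpos_of_nonneg hsep (by linarith)
  have hD : 0 < B ^ 2 - A * B := by have := sq_pos_of_ne_zero hB0; nlinarith
  obtain ⟨s, r, hs, hr, hsr, hsA⟩ : ∃ s r : ℝ, 0 < s ∧ 0 ≤ r ∧ s + r = 1 ∧ s * A + r * B = 0 := by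
    refine ⟨B ^ 2 / (B ^ 2 - A * B), -(A * B) / (B ^ 2 - A * B), ?_, ?_, ?_, ?_⟩
    · have := sq_pos_of_ne_zero hB0; positivity
    · exact div_nonneg (by linarith) hD.le
    · rw [← add_div, div_eq_one_iff_eq hD.ne']; ring
    · field_simp; ring
  obtain rfl : s = 1 - r := by linarith
  set w := (1 - r) • a' + r • p with hw
  have hwP : w ∈ P := hP ha'.1 hp.1.2 hs.le hr hsr
  have hφw : φ w - c = (1 - r) * (φ a' - c) := by simp [hw, hpc]; ring
  have hφa : 0 < φ a - c := by linarith
  set α := (φ w - c) / (φ a - c) with hαdef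
  have hα : 0 < α := by
    have : 0 < φ w - c := by rw [hφw]; exact mul_pos hs (by linarith)
    positivity
  have hαm : α * (φ a - c) = φ w - c := by rw [hαdef]; field_simp
  obtain ⟨γ, hγ⟩ : ∃ γ : ℝ, w - α • a - (1 - α) • x = γ • (y - x) := by
    set u := w - α • a - (1 - α) • x with hu
    have hφu : φ u = 0 := by
      simp only [hu, map_sub, map_smul, smul_eq_mul, hxc]; linarith
    have hdet : (g₁ y - g₁ x) * g₂ u = (g₂ y - g₂ x) * g₁ u := by
      have h1 : ((g₁ y - g₁ x) * g₂ u - (g₂ y - g₂ x) * g₁ u) * (φ a - c) =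
          orient g₁ g₂ x y w * (φ a - c) - α * (φ a - c) * orient g₁ g₂ x y a := by
        simp only [hu, map_sub, map_smul, smul_eq_mul, orient]; ring
      have h2 : orient g₁ g₂ x y w = (1 - r) * orient g₁ g₂ x y a' + r * orient g₁ g₂ x y p := by
        simp only [hw, map_add, map_smul, smul_eq_mul, orient]; ring
      have h3 : ((g₁ y - g₁ x) * g₂ u - (g₂ y - g₂ x) * g₁ u) * (φ a - c) = 0 := by
        rw [h1, h2, hαm, hφw, ← hsA, hA, hB]; ring
      have := (mul_eq_zero.1 h3).resolve_right hφa.ne'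
      linarith
    by_cases h1 : g₁ y - g₁ x = 0
    · have h2 : g₂ y - g₂ x ≠ 0 := fun h2 => hxy
        (sub_eq_zero.1 (hinj (y - x) (by simp [hxc, hyc]) (by simpa using h1)
          (by simpa using h2))).symm
      have h3 : g₁ u = 0 := by
        rw [h1, zero_mul] at hdet
        exact (mul_eq_zero.1 hdet.symm).resolve_left h2
      refine ⟨g₂ u / (g₂ y - g₂ x), sub_eq_zero.1 (hinj _ ?_ ?_ ?_)⟩
      · simp [hφu, hxc, hyc]
      · simp [h3, h1]
      · simp only [map_sub, map_smul, smul_eq_mul]; field_simp; ring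
    · refine ⟨g₁ u / (g₁ y - g₁ x), sub_eq_zero.1 (hinj _ ?_ ?_ ?_)⟩
      · simp [hφu, hxc, hyc]
      · simp only [map_sub, map_smul, smul_eq_mul]; field_simp; ring
      · simp only [map_sub, map_smul, smul_eq_mul]; field_simp; linarith
  have hwe : w = α • a + (1 - α - γ) • x + γ • y := by
    have : w = (w - α • a - (1 - α) • x) + α • a + (1 - α) • x := by module
    rw [this, hγ]; module
  have hβ0 : 0 ≤ 1 - α - γ :=
    barycentric_nonneg hP ha hac hx hy hxy hby hbyc hyb hwP hα (by ring) hwe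
  have hγ0 : 0 ≤ γ := barycentric_nonneg (β := γ) (γ := 1 - α - γ) hP ha hac hy hx hxy.symm hbx hbxc
    hxb hwP hα (by ring) (by rw [hwe]; module)
  rcases hr.eq_or_lt with hr0 | hr0
  · -- `w = a'` is extreme in the triangle
    have hwa : w = a' := by rw [hw, ← hr0]; simp
    by_cases hα1 : α = 1
    · have : γ = 0 := by linarith
      rw [hwa, this, hα1] at hwe
      simpa using hwe.symm
    have hα1' : 0 < 1 - α := by
      rcases lt_or_gt_of_ne hα1 with h | h <;> linarith
    have hq : ((1 - α - γ) / (1 - α)) • x + (γ / (1 - α)) • y ∈ P :=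
      hP hx.1.2 hy.1.2 (by positivity) (by positivity) (by field_simp; ring)
    have := ha'.2 hq ha.1 ⟨1 - α, α, hα1', hα, by ring, by
      rw [← hwa, hwe]; match_scalars <;> field_simp⟩
    have h2 := congrArg φ this
    rw [map_add, map_smul, map_smul, hxc, hyc, ← add_smul, ← add_div,
      show (1 - α - γ + γ) / (1 - α) = 1 by field_simp; ring, one_smul] at h2
    linarith
  · have hwp : w ∈ openSegment ℝ a' p := ⟨_, _, hs, hr0, hsr, rfl⟩
    have hwb := mem_openSegment_of_mem_openSegment hpb hwp
    -- a corner `z ≠ p` of the triangle on the hyperplane cannot carry weight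
    have hcorner : ∀ z z' : E, z ∈ P → z' ∈ P → φ z = c → z ≠ p → ∀ δ δ' : ℝ, 0 < δ → 0 ≤ δ' →
        α + δ + δ' = 1 → w = α • a + δ • z + δ' • z' → False := by
      intro z z' hz hz' hzc hzp δ δ' hδ hδ' hs1 hwz
      have hαδ : 0 < α + δ' := by linarith
      have hq : (α / (α + δ')) • a + (δ' / (α + δ')) • z' ∈ P :=
        hP ha.1 hz' (by positivity) (by positivity) (by field_simp)
      obtain ⟨τ, hτ⟩ := exists_eq_smul_of_mem_openSegment hP hp ha'.1 hbp (by linarith) hpb hwb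
        hz hq
        ⟨δ, α + δ', hδ, hαδ, by linarith, by rw [hwz]; match_scalars <;> field_simp⟩
      obtain ⟨ρ, hρ⟩ := exists_eq_add_smul_of_mem_openSegment hpb hwb
      have hze : z = p + (ρ - (α + δ') * τ) • (bp - a') := by
        have h1 : z = w - (α + δ') • (((α / (α + δ')) • a + (δ' / (α + δ')) • z') - z) := by
          rw [hwz]
          obtain rfl : δ = 1 - (α + δ') := by linarith
          match_scalars <;> field_simp <;> ring
        rw [h1, hτ, hρ]; module
      exact hzp (eq_of_eq_add_smul (φ := φ) (by rw [map_sub]; linarith) hze (hpc.trans hzc.symm))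
    rcases hβ0.eq_or_lt with hβ1 | hβ1
    · rcases hγ0.eq_or_lt with hγ1 | hγ1
      · have hwa : w = a := by
          have : α = 1 := by linarith
          rw [hwe, ← hβ1, ← hγ1, this]; simp
        rw [hwa] at hwp
        exact (ha.2 ha'.1 hp.1.2 hwp).symm
      · exact (hcorner y x hy.1.2 hx.1.2 hyc hyp γ (1 - α - γ) hγ1 hβ0 (by ring)
          (by rw [hwe]; module)).elim
    · exact (hcorner x y hx.1.2 hy.1.2 hxc hxp (1 - α - γ) γ hβ1 hγ0 (by ring) hwe).elim

/-- In dimension three, edges from two distinct vertices on one side of the hyperplane do not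
interlace along the boundary of the slice. -/
lemma eq_of_separated (hinj : ∀ v, φ v = 0 → g₁ v = 0 → g₂ v = 0 → v = 0)
    (hP : Convex ℝ P) {z bz bw : E} (ha : a ∈ P.extremePoints ℝ) (ha' : a' ∈ P.extremePoints ℝ)
    (hac : c < φ a) (hac' : c < φ a')
    (hx : x ∈ ({v | φ v = c} ∩ P).extremePoints ℝ) (hy : y ∈ ({v | φ v = c} ∩ P).extremePoints ℝ)
    (hz : z ∈ ({v | φ v = c} ∩ P).extremePoints ℝ) (hw : w ∈ ({v | φ v = c} ∩ P).extremePoints ℝ)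
    (hbx : bx ∈ P) (hbxc : φ bx < c) (hxb : x ∈ openSegment ℝ a bx)
    (hby : b_y ∈ P) (hbyc : φ b_y < c) (hyb : y ∈ openSegment ℝ a b_y)
    (hbz : bz ∈ P) (hbzc : φ bz < c) (hzb : z ∈ openSegment ℝ a' bz)
    (hbw : bw ∈ P) (hbwc : φ bw < c) (hwb : w ∈ openSegment ℝ a' bw)
    (hz0 : orient g₁ g₂ x y z < 0) (hw0 : 0 < orient g₁ g₂ x y w) : a = a' := by
  rcases le_total 0 (orient g₁ g₂ x y a' * (φ a - c) - orient g₁ g₂ x y a * (φ a' - c)) with h | h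
  · exact eq_of_orient_mul_nonpos hinj hP ha ha' hac hac' hx hy hz hbx hbxc hxb hby hbyc hyb
      hbz hbzc hzb hz0.ne (mul_nonpos_of_nonneg_of_nonpos h hz0.le)
  · exact eq_of_orient_mul_nonpos hinj hP ha ha' hac hac' hx hy hw hbx hbxc hxb hby hbyc hyb
      hbw hbwc hwb hw0.ne' (mul_nonpos_of_nonpos_of_nonneg h hw0.le)

end Noncrossing

/-! ### Cyclic sequences and points in convex position -/

section CyclicOrder

/-- A sequence without interlacing pairs of equal terms with `r` values changes its value at most
`2 (r - 1)` times: at each change either the new value occurs for the first time or the old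
value occurs for the last time. -/
lemma card_changes_le {α : Type*} [DecidableEq α] (f : ℕ → α) (m : ℕ) (s : Finset α)
    (hf : ∀ i ≤ m, f i ∈ s)
    (hnc : ∀ i j k l, i < j → j < k → k < l → l ≤ m → f i = f k → f j = f l → f i = f j) :
    ((Finset.range m).filter fun i => f i ≠ f (i + 1)).card ≤ 2 * (s.card - 1) := by
  classical
  set C := (Finset.range m).filter fun i => f i ≠ f (i + 1) with hC
  have hmem : ∀ i, i ∈ C ↔ i < m ∧ f i ≠ f (i + 1) := by simp [hC]
  rw [← Finset.card_filter_add_card_filter_not (s := C) (fun i => ∀ j ≤ i, f j ≠ f (i + 1)),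
    two_mul]
  apply add_le_add
  · rw [← Finset.card_erase_of_mem (hf 0 (Nat.zero_le m))]
    refine Finset.card_le_card_of_injOn (fun i => f (i + 1)) ?_ ?_
    · intro i hi
      obtain ⟨hi, hi'⟩ := Finset.mem_filter.1 (Finset.mem_coe.1 hi)
      exact Finset.mem_coe.2 (Finset.mem_erase.2
        ⟨(hi' 0 (Nat.zero_le i)).symm, hf _ ((hmem i).1 hi).1⟩)
    · intro i hi j hj hij
      obtain ⟨hi, hi'⟩ := Finset.mem_filter.1 (Finset.mem_coe.1 hi)
      obtain ⟨hj, hj'⟩ := Finset.mem_filter.1 (Finset.mem_coe.1 hj)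
      rcases lt_trichotomy i j with h | h | h
      · exact absurd hij (hj' (i + 1) h)
      · exact h
      · exact absurd hij.symm (hi' (j + 1) h)
  · rw [← Finset.card_erase_of_mem (hf m le_rfl)]
    have hlast : ∀ i ∈ C.filter (fun i => ¬ ∀ j ≤ i, f j ≠ f (i + 1)), i < m ∧
        ∀ l, i < l → l ≤ m → f l ≠ f i := by
      intro i hi
      obtain ⟨hi, hi'⟩ := Finset.mem_filter.1 hi
      obtain ⟨him, hne⟩ := (hmem i).1 hi
      push Not at hi'
      obtain ⟨j, hji, hj⟩ := hi'
      refine ⟨him, fun l hil hlm hl => ?_⟩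
      have hji' : j < i := lt_of_le_of_ne hji (by rintro rfl; exact hne hj)
      have hil' : i + 1 < l := lt_of_le_of_ne hil (by rintro rfl; exact hne hl.symm)
      exact hne ((hnc j i (i + 1) l hji' (Nat.lt_succ_self i) hil' hlm hj hl.symm).symm.trans hj)
    refine Finset.card_le_card_of_injOn f ?_ ?_
    · intro i hi
      obtain ⟨him, h⟩ := hlast i (Finset.mem_coe.1 hi)
      exact Finset.mem_coe.2 (Finset.mem_erase.2 ⟨(h m him le_rfl).symm, hf i him.le⟩)
    · intro i hi j hj hij
      obtain ⟨him, h⟩ := hlast i (Finset.mem_coe.1 hi)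
      obtain ⟨hjm, h'⟩ := hlast j (Finset.mem_coe.1 hj)
      rcases lt_trichotomy i j with hlt | hlt | hlt
      · exact absurd hij.symm (h j hlt hjm.le)
      · exact hlt
      · exact absurd hij (h' i hlt him.le)

variable {E : Type*} [AddCommGroup E] [Module ℝ E] {φ g₁ g₂ : E →ₗ[ℝ] ℝ} {c : ℝ}

/-- A linear coordinate can be perturbed to separate the points of a finite set in the plane. -/
lemma exists_coordinate_injOn (hinj : ∀ v, φ v = 0 → g₁ v = 0 → g₂ v = 0 → v = 0)
    (X : Finset E) (hX : ∀ x ∈ X, φ x = c) :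
    ∃ g : E →ₗ[ℝ] ℝ, (∀ v, φ v = 0 → g v = 0 → g₂ v = 0 → v = 0) ∧ Set.InjOn g X := by
  classical
  obtain ⟨η, hη⟩ := Infinite.exists_notMem_finset
    ((X ×ˢ X).image fun q => -(g₁ (q.1 - q.2)) / g₂ (q.1 - q.2))
  refine ⟨g₁ + η • g₂, fun v h0 h1 h2 => hinj v h0 ?_ h2, ?_⟩
  · simpa [h2] using h1
  · intro x hx y hy hxy
    have h1 : g₁ (x - y) + η * g₂ (x - y) = 0 := by
      simp only [LinearMap.add_apply, LinearMap.smul_apply, smul_eq_mul] at hxy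
      simp only [map_sub]; linarith
    have h0 : φ (x - y) = 0 := by simp [hX x hx, hX y hy]
    by_cases h2 : g₂ (x - y) = 0
    · rw [h2, mul_zero, add_zero] at h1
      exact sub_eq_zero.1 (hinj _ h0 h1 h2)
    · refine absurd (Finset.mem_image.2 ⟨(x, y), Finset.mem_product.2 ⟨hx, hy⟩, ?_⟩) hη
      field_simp
      linarith

/-- Finitely many points in convex position in a plane can be listed counterclockwise. -/
lemma exists_counterclockwise (hinj : ∀ v, φ v = 0 → g₁ v = 0 → g₂ v = 0 → v = 0)
    {Q : Set E} (hQ : Convex ℝ Q) (X : Finset E) (hXφ : ∀ x ∈ X, φ x = c)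
    (hXQ : ∀ x ∈ X, x ∈ Q.extremePoints ℝ) (hg : Set.InjOn g₁ X) (hne : X.Nonempty) :
    ∃ e : ℕ → E, (∀ i, e i ∈ X) ∧ e X.card = e 0 ∧
      (∀ i j, i < j → j < X.card → e i ≠ e j) ∧
      ∀ i j k, i < j → j < k → k < X.card → 0 < orient g₁ g₂ (e i) (e j) (e k) := by
  classical
  obtain ⟨o, ho, hmin⟩ := X.exists_min_image g₁ hne
  set Y := X.erase o with hY
  have hYX : ∀ x ∈ Y, x ∈ X := fun x hx => Finset.mem_of_mem_erase hx
  have hpos : ∀ x ∈ Y, 0 < g₁ x - g₁ o := by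
    intro x hx
    rw [sub_pos]
    exact lt_of_le_of_ne (hmin x (hYX x hx))
      fun h => (Finset.ne_of_mem_erase hx) (hg (hYX x hx) ho h.symm)
  -- sort the remaining points by their slope seen from the leftmost point
  set σ : E → ℝ := fun x => (g₂ x - g₂ o) / (g₁ x - g₁ o) with hσ
  have hor : ∀ x ∈ Y, ∀ y ∈ Y, orient g₁ g₂ o x y =
      (g₁ x - g₁ o) * (g₁ y - g₁ o) * (σ y - σ x) := by
    intro x hx y hy
    have h1 := (hpos x hx).ne'
    have h2 := (hpos y hy).ne'
    simp only [orient, hσ]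
    field_simp
  have hσlt : ∀ x ∈ Y, ∀ y ∈ Y, σ x = σ y → g₁ x < g₁ y → False := by
    intro x hx y hy hxy hlt
    have h1 := (hpos x hx)
    have h2 := (hpos y hy)
    have hxe : x = o + ((g₁ x - g₁ o) / (g₁ y - g₁ o)) • (y - o) := by
      refine sub_eq_zero.1 (hinj _ ?_ ?_ ?_)
      · simp [hXφ x (hYX x hx), hXφ y (hYX y hy), hXφ o ho]
      · simp only [map_sub, map_add, map_smul, smul_eq_mul]; field_simp; ring
      · simp only [hσ] at hxy
        simp only [map_sub, map_add, map_smul, smul_eq_mul]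
        field_simp at hxy ⊢
        linarith
    refine (Finset.ne_of_mem_erase hx) ((hXQ x (hYX x hx)).2 (hXQ o ho).1
      (hXQ y (hYX y hy)).1 ⟨1 - (g₁ x - g₁ o) / (g₁ y - g₁ o), (g₁ x - g₁ o) / (g₁ y - g₁ o),
        ?_, by positivity, by ring, ?_⟩).symm
    · rw [sub_pos, div_lt_one h2]; linarith
    · conv_rhs => rw [hxe]
      module
  have hσinj : Set.InjOn σ Y := by
    intro x hx y hy hxy
    rcases lt_trichotomy (g₁ x) (g₁ y) with h | h | h
    · exact (hσlt x hx y hy hxy h).elim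
    · exact hg (hYX x hx) (hYX y hy) h
    · exact (hσlt y hy x hx hxy.symm h).elim
  have hcard : (Y.image σ).card = X.card - 1 := by
    rw [Finset.card_image_of_injOn hσinj, hY, Finset.card_erase_of_mem ho]
  have hXc : 0 < X.card := hne.card_pos
  set F := (Y.image σ).orderEmbOfFin hcard with hF
  have hpre : ∀ i, ∃ x ∈ Y, σ x = F i := fun i =>
    Finset.mem_image.1 (Finset.orderEmbOfFin_mem (Y.image σ) hcard i)
  choose h hhY hhσ using hpre
  set e : ℕ → E := fun i => if hi : i ≠ 0 ∧ i - 1 < X.card - 1 then h ⟨i - 1, hi.2⟩ else o with he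
  have he0 : e 0 = o := by simp [he]
  have heY : ∀ i, 0 < i → i < X.card → e i ∈ Y := by
    intro i h0 h1
    have : i ≠ 0 ∧ i - 1 < X.card - 1 := by omega
    simp only [he, dif_pos this]; exact hhY _
  have hlt : ∀ i j, 0 < i → i < j → j < X.card → σ (e i) < σ (e j) := by
    intro i j h0 h1 h2
    have h3 : i ≠ 0 ∧ i - 1 < X.card - 1 := by omega
    have h4 : j ≠ 0 ∧ j - 1 < X.card - 1 := by omega
    simp only [he, dif_pos h3, dif_pos h4, hhσ]
    apply F.strictMono
    simp only [Fin.mk_lt_mk]; omega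
  have h0 : ∀ i j, 0 < i → i < j → j < X.card → 0 < orient g₁ g₂ o (e i) (e j) := by
    intro i j h0 h1 h2
    rw [hor _ (heY i h0 (h1.trans h2)) _ (heY j (h0.trans h1) h2)]
    exact mul_pos (mul_pos (hpos _ (heY i h0 (h1.trans h2))) (hpos _ (heY j (h0.trans h1) h2)))
      (sub_pos.2 (hlt i j h0 h1 h2))
  have heX : ∀ i, e i ∈ X := by
    intro i
    by_cases hi : i ≠ 0 ∧ i - 1 < X.card - 1
    · exact hYX _ (heY i (by omega) (by omega))
    · simp only [he, dif_neg hi]; exact ho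
  refine ⟨e, heX, ?_, ?_, ?_⟩
  · rw [he0]
    simp [he]
  · intro i j hij hj
    rcases Nat.eq_zero_or_pos i with rfl | hi
    · rw [he0]
      exact (Finset.ne_of_mem_erase (heY j hij hj)).symm
    · intro h
      exact (hlt i j hi hij hj).ne (by rw [h])
  · intro i j k hij hjk hk
    rcases Nat.eq_zero_or_pos i with rfl | hi
    · rw [he0]
      exact h0 j k hij hjk hk
    -- otherwise `e j` would lie in the triangle `o, e i, e k`
    by_contra hcon
    push Not at hcon
    have hik := h0 i k hi (hij.trans hjk) hk
    have hij' := h0 i j hi hij (hjk.trans hk)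
    have hjk' := h0 j k (hi.trans hij) hjk hk
    set D := orient g₁ g₂ o (e i) (e k)
    set D₀ := orient g₁ g₂ (e i) (e j) (e k) with hD₀
    set Dk := orient g₁ g₂ o (e i) (e j)
    set Di := orient g₁ g₂ o (e j) (e k)
    have hs : -D₀ + Di + Dk = D := by
      simp only [D₀, Di, Dk, D, orient]; ring
    have hbar : e j = (-D₀ / D) • o + (Di / D) • e i + (Dk / D) • e k := by
      have hb : D • e j - (-D₀ • o + Di • e i + Dk • e k) = 0 := by
        refine hinj _ ?_ ?_ ?_
        · simp only [map_sub, map_add, map_smul, smul_eq_mul, hXφ _ (heX _), hXφ o ho, ← hs]; ring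
        · simp only [map_sub, map_add, map_smul, smul_eq_mul, D₀, Di, Dk, D, orient]; ring
        · simp only [map_sub, map_add, map_smul, smul_eq_mul, D₀, Di, Dk, D, orient]; ring
      have hb' : e j = D⁻¹ • (D • e j) := by rw [smul_smul, inv_mul_cancel₀ hik.ne', one_smul]
      rw [hb', sub_eq_zero.1 hb]
      module
    have hk0 : 0 < -D₀ + Dk := by linarith
    have hq : (-D₀ / (-D₀ + Dk)) • o + (Dk / (-D₀ + Dk)) • e k ∈ Q :=
      hQ (hXQ o ho).1 (hXQ _ (heX k)).1 (div_nonneg (by linarith) hk0.le)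
        (by positivity) (by field_simp)
    have := (hXQ _ (heX j)).2 (hXQ _ (heX i)).1 hq
      ⟨Di / D, (-D₀ + Dk) / D, by positivity, by positivity, by field_simp; linarith, by
        conv_rhs => rw [hbar]
        match_scalars <;> field_simp⟩
    exact (hlt i j hi hij (hjk.trans hk)).ne (by rw [this])

end CyclicOrder

/-! ### The planar bound -/

section Planar

variable {E : Type*} [AddCommGroup E] [Module ℝ E] {P : Set E} {φ g₁ g₂ : E →ₗ[ℝ] ℝ} {c : ℝ}

/-- A planar slice has at most `2 (p - 1) + 2 (q - 1)` vertices interior to edges, for `p` and `q`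
vertices on the two sides. Going around the slice, each step changes the upper or the lower
endpoint of the edge. -/
lemma card_le_of_planar_slice (hinj : ∀ v, φ v = 0 → g₁ v = 0 → g₂ v = 0 → v = 0)
    (hP : Convex ℝ P) (A B X : Finset E) (hA : ∀ a ∈ A, a ∈ P.extremePoints ℝ ∧ c < φ a)
    (hB : ∀ b ∈ B, b ∈ P.extremePoints ℝ ∧ φ b < c)
    (hX : ∀ x ∈ X, x ∈ ({y | φ y = c} ∩ P).extremePoints ℝ)
    (top bot : E → E) (htop : ∀ x ∈ X, top x ∈ A) (hbot : ∀ x ∈ X, bot x ∈ B)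
    (hseg : ∀ x ∈ X, x ∈ openSegment ℝ (top x) (bot x)) (hcard : 2 ≤ X.card) :
    X.card ≤ 2 * (A.card - 1) + 2 * (B.card - 1) := by
  classical
  have hXc : ∀ x ∈ X, φ x = c := fun x hx => (hX x hx).1.1
  obtain ⟨g, hg, hgX⟩ := exists_coordinate_injOn hinj X hXc
  have hQ : Convex ℝ ({y | φ y = c} ∩ P) := (convex_hyperplane φ.isLinear c).inter hP
  obtain ⟨e, heX, hcyc, hne, hor⟩ := exists_counterclockwise hg hQ X hXc hX hgX
    (Finset.card_pos.1 (by omega))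
  set m := X.card with hm
  have hsep : ∀ i j k l, i < j → j < k → k < l → l ≤ m → ¬ (i = 0 ∧ l = m) →
      orient g g₂ (e i) (e k) (e j) < 0 ∧ 0 < orient g g₂ (e i) (e k) (e l) := by
    intro i j k l hij hjk hkl hlm hne'
    constructor
    · have := hor i j k hij hjk (hkl.trans_le hlm)
      have h2 : orient g g₂ (e i) (e k) (e j) = - orient g g₂ (e i) (e j) (e k) := by
        simp only [orient]; ring
      linarith
    · rcases hlm.lt_or_eq with h | h
      · exact hor i k l (hij.trans hjk) hkl h
      · rw [h, hcyc]
        have := hor 0 i k (by omega) (hij.trans hjk) (hkl.trans_le hlm)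
        have h2 : orient g g₂ (e i) (e k) (e 0) = orient g g₂ (e 0) (e i) (e k) := by
          simp only [orient]; ring
        linarith
  have hcirc : ∀ f : E → E, ∀ i j k l, i < j → j < k → k < l → l ≤ m → f (e i) = f (e k) →
      f (e j) = f (e l) →
      (orient g g₂ (e i) (e k) (e j) < 0 → 0 < orient g g₂ (e i) (e k) (e l) → f (e i) = f (e j)) →
      f (e i) = f (e j) := by
    intro f i j k l hij hjk hkl hlm hik hjl hsep'
    by_cases h : i = 0 ∧ l = m
    · rw [hjl, h.1, h.2, hcyc]
    · obtain ⟨h1, h2⟩ := hsep i j k l hij hjk hkl hlm h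
      exact hsep' h1 h2
  have htopc := card_changes_le (fun i => top (e i)) m A (fun i _ => htop _ (heX i)) (by
    intro i j k l hij hjk hkl hlm hik hjl
    refine hcirc top i j k l hij hjk hkl hlm hik hjl fun h1 h2 => ?_
    have hb : ∀ i, bot (e i) ∈ P ∧ φ (bot (e i)) < c := fun i =>
      ⟨(hB _ (hbot _ (heX i))).1.1, (hB _ (hbot _ (heX i))).2⟩
    have ha : ∀ i, top (e i) ∈ P.extremePoints ℝ ∧ c < φ (top (e i)) := fun i =>
      hA _ (htop _ (heX i))
    exact eq_of_separated hg hP (ha i).1 (ha j).1 (ha i).2 (ha j).2 (hX _ (heX i)) (hX _ (heX k))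
      (hX _ (heX j)) (hX _ (heX l)) (hb i).1 (hb i).2 (hseg _ (heX i)) (hb k).1 (hb k).2
      (by rw [hik]; exact hseg _ (heX k)) (hb j).1 (hb j).2 (hseg _ (heX j))
      (hb l).1 (hb l).2 (by rw [hjl]; exact hseg _ (heX l)) h1 h2)
  have hbotc := card_changes_le (fun i => bot (e i)) m B (fun i _ => hbot _ (heX i)) (by
    intro i j k l hij hjk hkl hlm hik hjl
    refine hcirc bot i j k l hij hjk hkl hlm hik hjl fun h1 h2 => ?_
    -- exchange the two sides by passing to `-φ`
    have hslice : ({y | φ y = c} ∩ P) = ({y | (-φ) y = -c} ∩ P) := by simp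
    have ha : ∀ i, top (e i) ∈ P ∧ (-φ) (top (e i)) < -c := fun i =>
      ⟨(hA _ (htop _ (heX i))).1.1, by simpa using (hA _ (htop _ (heX i))).2⟩
    have hb : ∀ i, bot (e i) ∈ P.extremePoints ℝ ∧ -c < (-φ) (bot (e i)) := fun i =>
      ⟨(hB _ (hbot _ (heX i))).1, by simpa using (hB _ (hbot _ (heX i))).2⟩
    have hX' : ∀ i, e i ∈ ({y | (-φ) y = -c} ∩ P).extremePoints ℝ := fun i => by
      rw [← hslice]; exact hX _ (heX i)
    have hseg' : ∀ i, e i ∈ openSegment ℝ (bot (e i)) (top (e i)) := fun i => by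
      rw [openSegment_symm]; exact hseg _ (heX i)
    exact eq_of_separated (φ := -φ) (fun v h => hg v (by simpa using h)) hP (hb i).1 (hb j).1
      (hb i).2 (hb j).2 (hX' i) (hX' k) (hX' j) (hX' l) (ha i).1 (ha i).2 (hseg' i)
      (ha k).1 (ha k).2 (by rw [hik]; exact hseg' k) (ha j).1 (ha j).2 (hseg' j)
      (ha l).1 (ha l).2 (by rw [hjl]; exact hseg' l) h1 h2)
  calc m = (Finset.range m).card := (Finset.card_range m).symm
    _ ≤ (((Finset.range m).filter fun i => top (e i) ≠ top (e (i + 1))) ∪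
        ((Finset.range m).filter fun i => bot (e i) ≠ bot (e (i + 1)))).card := by
      apply Finset.card_le_card
      intro i hi
      rw [← Finset.filter_or, Finset.mem_filter]
      refine ⟨hi, ?_⟩
      by_contra hcon
      push Not at hcon
      have him := Finset.mem_range.1 hi
      have hxe : e i = e (i + 1) := by
        have hab : φ (top (e i)) ≠ φ (bot (e i)) := by
          have h1 := (hA _ (htop _ (heX i))).2
          have h2 := (hB _ (hbot _ (heX i))).2
          linarith
        refine eq_of_mem_openSegment hab (hseg _ (heX i)) ?_
          ((hXc _ (heX i)).trans (hXc _ (heX _)).symm)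
        rw [hcon.1, hcon.2]
        exact hseg _ (heX (i + 1))
      rcases (Nat.succ_le_of_lt him).lt_or_eq with h | h
      · exact hne i (i + 1) (Nat.lt_succ_self i) h hxe
      · rw [show i + 1 = m from h, hcyc] at hxe
        exact hne 0 i (by omega) him hxe.symm
    _ ≤ _ := (Finset.card_union_le _ _).trans (add_le_add htopc hbotc)

end Planar

/-! ### Faces and a lower bound for slices -/

section Faces

variable {E : Type*} [AddCommGroup E] [Module ℝ E] {S : Finset E} {f φ : E →ₗ[ℝ] ℝ} {κ c : ℝ}
  {x y z a b : E}

lemma le_of_mem_convexHull (hf : ∀ v ∈ S, κ ≤ f v) (hy : y ∈ convexHull ℝ (S : Set E)) :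
    κ ≤ f y :=
  convexHull_min (t := {v | κ ≤ f v}) hf (convex_halfSpace_ge f.isLinear κ) hy

lemma mem_convexHull_filter (hf : ∀ v ∈ S, κ ≤ f v) (hy : y ∈ convexHull ℝ (S : Set E))
    (hyκ : f y = κ) : y ∈ convexHull ℝ {v | v ∈ S ∧ f v = κ} := by
  classical
  obtain ⟨w, h0, h1, hsum⟩ := Finset.mem_convexHull'.1 hy
  have h2 : ∑ v ∈ S, w v * (f v - κ) = 0 := by
    have h3 := congrArg f hsum
    simp only [map_sum, map_smul, smul_eq_mul] at h3
    simp only [mul_sub, Finset.sum_sub_distrib, ← Finset.sum_mul, h1, h3, hyκ]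
    ring
  have h3 := (Finset.sum_eq_zero_iff_of_nonneg
    fun v hv => mul_nonneg (h0 v hv) (sub_nonneg.2 (hf v hv))).1 h2
  have h4 : ∀ v ∈ S, ¬ f v = κ → w v = 0 := fun v hv hne =>
    (mul_eq_zero.1 (h3 v hv)).resolve_right (sub_ne_zero.2 hne)
  have : ({v | v ∈ S ∧ f v = κ} : Set E) = (S.filter fun v => f v = κ : Finset E) := by
    ext; simp
  rw [this]
  refine Finset.mem_convexHull'.2 ⟨w, fun v hv => h0 v (Finset.mem_filter.1 hv).1, ?_, ?_⟩
  · rw [Finset.sum_filter_of_ne, h1]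
    exact fun v hv hne => by_contra fun h => hne (h4 v hv h)
  · rw [Finset.sum_filter_of_ne, hsum]
    exact fun v hv hne => by_contra fun h => hne (by rw [h4 v hv h, zero_smul])

lemma eq_of_mem_openSegment_of_le (hy : κ ≤ f y) (hz : κ ≤ f z) (hx : f x = κ)
    (h : x ∈ openSegment ℝ y z) : f y = κ ∧ f z = κ := by
  obtain ⟨s, t, hs, ht, hst, rfl⟩ := h
  simp only [map_add, map_smul, smul_eq_mul] at hx
  obtain rfl : s = 1 - t := by linarith
  constructor <;> nlinarith

lemma mem_extremePoints_of_unique_min (hf : ∀ v ∈ S, κ ≤ f v) (ha : a ∈ S) (haκ : f a = κ)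
    (huniq : ∀ v ∈ S, f v = κ → v = a) : a ∈ (convexHull ℝ (S : Set E)).extremePoints ℝ := by
  refine ⟨subset_convexHull ℝ _ ha, fun y hy z hz h => ?_⟩
  obtain ⟨h1, -⟩ := eq_of_mem_openSegment_of_le (le_of_mem_convexHull hf hy)
    (le_of_mem_convexHull hf hz) haκ h
  have h2 := mem_convexHull_filter hf hy h1
  have h3 := convexHull_mono (t := {a}) (fun v hv => huniq v hv.1 hv.2) h2
  rwa [convexHull_singleton] at h3

lemma mem_openSegment_of_mem_segment (hy : y ∈ segment ℝ a b) (ha : φ y ≠ φ a) (hb : φ y ≠ φ b) :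
    y ∈ openSegment ℝ a b := by
  obtain ⟨s, t, hs, ht, hst, rfl⟩ := hy
  refine ⟨s, t, hs.lt_of_ne ?_, ht.lt_of_ne ?_, hst, rfl⟩
  · rintro rfl
    obtain rfl : t = 1 := by linarith
    simp at hb
  · rintro rfl
    obtain rfl : s = 1 := by linarith
    simp at ha

lemma exists_mem_openSegment_of_lt (ha : c < φ a) (hb : φ b < c) :
    ∃ x ∈ openSegment ℝ a b, φ x = c := by
  have h : 0 < φ a - φ b := by linarith
  refine ⟨_, ⟨(c - φ b) / (φ a - φ b), (φ a - c) / (φ a - φ b), div_pos (by linarith) h,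
    div_pos (by linarith) h, by field_simp; ring, rfl⟩, ?_⟩
  simp only [map_add, map_smul, smul_eq_mul]
  field_simp
  ring

/-- If every segment from `A` to `B` is an edge of the polytope, cut out by a supporting
functional, a hyperplane separating `A` from `B` cuts the polytope in a slice with at least
`|A| |B|` vertices. -/
lemma card_mul_card_le_encard_extremePoints (A B : Finset E) (hAS : A ⊆ S) (hBS : B ⊆ S)
    (hA : ∀ a ∈ A, c < φ a) (hB : ∀ b ∈ B, φ b < c)
    (hedge : ∀ a ∈ A, ∀ b ∈ B, ∃ (f : E →ₗ[ℝ] ℝ) (κ : ℝ), (∀ v ∈ S, κ ≤ f v) ∧ f a = κ ∧ f b = κ ∧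
      ∀ v ∈ S, f v = κ → v = a ∨ v = b) :
    ((A.card * B.card : ℕ) : ℕ∞) ≤
      (({y | φ y = c} ∩ convexHull ℝ (S : Set E)).extremePoints ℝ).encard := by
  classical
  have hex : ∀ q : E × E, ∃ x, q ∈ A ×ˢ B → x ∈ openSegment ℝ q.1 q.2 ∧ φ x = c := by
    intro q
    by_cases hq : q ∈ A ×ˢ B
    · obtain ⟨h1, h2⟩ := Finset.mem_product.1 hq
      obtain ⟨x, hx⟩ := exists_mem_openSegment_of_lt (hA _ h1) (hB _ h2)
      exact ⟨x, fun _ => hx⟩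
    · exact ⟨0, fun h => absurd h hq⟩
  choose X hX using hex
  have hmaps : Set.MapsTo X (A ×ˢ B : Finset (E × E))
      (({y | φ y = c} ∩ convexHull ℝ (S : Set E)).extremePoints ℝ) := by
    rintro ⟨a, b⟩ hq
    obtain ⟨ha, hb⟩ := Finset.mem_product.1 (Finset.mem_coe.1 hq)
    obtain ⟨hx, hxc⟩ := hX (a, b) hq
    obtain ⟨f, κ, hf, hfa, hfb, huniq⟩ := hedge a ha b hb
    have hab : φ a ≠ φ b := ((hB b hb).trans (hA a ha)).ne'
    have hSP : ∀ v ∈ S, v ∈ convexHull ℝ (S : Set E) := fun v hv => subset_convexHull ℝ _ hv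
    refine ⟨⟨hxc, (convex_convexHull ℝ _).openSegment_subset (hSP a (hAS ha)) (hSP b (hBS hb)) hx⟩,
      fun y hy z hz h => ?_⟩
    have hxκ : f (X (a, b)) = κ := by
      obtain ⟨s, t, -, -, hst, hs⟩ := hx
      rw [← hs, map_add, map_smul, map_smul, hfa, hfb, ← add_smul, hst, one_smul]
    obtain ⟨h1, -⟩ := eq_of_mem_openSegment_of_le (le_of_mem_convexHull hf hy.2)
      (le_of_mem_convexHull hf hz.2) hxκ h
    have h2 := convexHull_mono (t := {a, b}) (fun v hv => huniq v hv.1 hv.2)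
      (mem_convexHull_filter hf hy.2 h1)
    rw [convexHull_pair] at h2
    have hyc : φ y = c := hy.1
    exact eq_of_mem_openSegment hab (mem_openSegment_of_mem_segment (φ := φ) h2
      (by rw [hyc]; exact (hA a ha).ne) (by rw [hyc]; exact (hB b hb).ne')) hx (hyc.trans hxc.symm)
  have hinj : Set.InjOn X (A ×ˢ B : Finset (E × E)) := by
    rintro ⟨a, b⟩ hq ⟨a', b'⟩ hq' hXX
    obtain ⟨ha, hb⟩ := Finset.mem_product.1 (Finset.mem_coe.1 hq)
    obtain ⟨ha', hb'⟩ := Finset.mem_product.1 (Finset.mem_coe.1 hq')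
    obtain ⟨hx, hxc⟩ := hX (a, b) hq
    obtain ⟨hx', -⟩ := hX (a', b') hq'
    obtain ⟨f, κ, hf, hfa, hfb, huniq⟩ := hedge a ha b hb
    have hxκ : f (X (a, b)) = κ := by
      obtain ⟨s, t, -, -, hst, hs⟩ := hx
      rw [← hs, map_add, map_smul, map_smul, hfa, hfb, ← add_smul, hst, one_smul]
    rw [← hXX] at hx'
    obtain ⟨h1, h2⟩ := eq_of_mem_openSegment_of_le (hf a' (hAS ha')) (hf b' (hBS hb')) hxκ hx'
    have hca := hA a ha
    have hca' := hA a' ha'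
    have hcb := hB b hb
    have hcb' := hB b' hb'
    have e1 : a' = a := by
      rcases huniq a' (hAS ha') h1 with h | h
      · exact h
      · rw [h] at hca'; linarith
    have e2 : b' = b := by
      rcases huniq b' (hBS hb') h2 with h | h
      · rw [h] at hcb'; linarith
      · exact h
    rw [e1, e2]
  have := Set.encard_le_encard_of_injOn hmaps hinj
  rwa [Set.encard_coe_eq_coe_finsetCard, Finset.card_product] at this

end Faces

/-! ### Cyclic polytopes -/

section Cyclic

open Polynomial

/-- The vector of the coefficients of `p` in degrees `1, …, d`; its inner product with a point of
the moment curve evaluates `p` up to the constant term. -/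
noncomputable def coeffVec (d : ℕ) (p : ℝ[X]) : EuclideanSpace ℝ (Fin d) :=
  WithLp.toLp 2 fun i : Fin d => p.coeff ((i : ℕ) + 1)

lemma inner_coeffVec_momentCurve {d : ℕ} {p : ℝ[X]} (hp : p.natDegree ≤ d) (s : ℝ) :
    inner ℝ (coeffVec d p) (momentCurve d s) = p.eval s - p.coeff 0 := by
  rw [eval_eq_sum_range' (Nat.lt_succ_of_le hp), Finset.sum_range_succ', ← Fin.sum_univ_eq_sum_range
    (fun i => p.coeff (i + 1) * s ^ (i + 1))]
  simp [coeffVec, momentCurve, PiLp.inner_apply, mul_comm]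

lemma momentCurve_injective {d : ℕ} (hd : 0 < d) : Function.Injective (momentCurve d) := by
  intro s t h
  have := congrArg (fun x : EuclideanSpace ℝ (Fin d) => x ⟨0, hd⟩) h
  simpa [momentCurve] using this

variable {d n : ℕ} {t : Fin n → ℝ}

open Classical in
/-- The points on the moment curve spanning the cyclic polytope. -/
noncomputable def cyclicVertices (d : ℕ) (t : Fin n → ℝ) : Finset (EuclideanSpace ℝ (Fin d)) :=
  Finset.univ.image fun i => momentCurve d (t i)

lemma cyclicPolytope_eq : cyclicPolytope d t =
    convexHull ℝ (cyclicVertices d t : Set (EuclideanSpace ℝ (Fin d))) := by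
  simp [cyclicPolytope, cyclicVertices]

/-- A polynomial of degree at most `d` that is nonnegative at the parameters, as a functional
supporting the cyclic polytope in the vertices given by its zeros. -/
lemma exists_supporting_functional {p : ℝ[X]} (hp : p.natDegree ≤ d) (h0 : ∀ i, 0 ≤ p.eval (t i)) :
    ∃ (f : EuclideanSpace ℝ (Fin d) →ₗ[ℝ] ℝ) (κ : ℝ), (∀ v ∈ cyclicVertices d t, κ ≤ f v) ∧
      (∀ s, f (momentCurve d s) = κ ↔ p.eval s = 0) := by
  refine ⟨innerₗ _ (coeffVec d p), - p.coeff 0, ?_, ?_⟩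
  · intro v hv
    obtain ⟨i, -, rfl⟩ := Finset.mem_image.1 hv
    rw [innerₗ_apply_apply, inner_coeffVec_momentCurve hp]
    linarith [h0 i]
  · intro s
    rw [innerₗ_apply_apply, inner_coeffVec_momentCurve hp]
    constructor <;> intro h <;> linarith

lemma extremePoints_cyclicPolytope (hd : 2 ≤ d) :
    vertexSet (cyclicPolytope d t) = (cyclicVertices d t : Set (EuclideanSpace ℝ (Fin d))) := by
  rw [vertexSet, cyclicPolytope_eq]
  refine Set.Subset.antisymm extremePoints_convexHull_subset ?_
  intro v hv
  have hv' := Finset.mem_coe.1 hv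
  obtain ⟨i, -, rfl⟩ := Finset.mem_image.1 hv'
  obtain ⟨f, κ, h1, h2⟩ := exists_supporting_functional (d := d) (t := t) (p := (X - C (t i)) ^ 2)
    (by rw [natDegree_pow, natDegree_X_sub_C]; omega) (fun j => by simp; positivity)
  refine mem_extremePoints_of_unique_min h1 hv' ((h2 _).2 (by simp)) ?_
  intro w hw hwκ
  obtain ⟨j, -, rfl⟩ := Finset.mem_image.1 hw
  have := (h2 _).1 hwκ
  simp only [eval_pow, eval_sub, eval_X, eval_C] at this
  rw [sub_eq_zero.1 (pow_eq_zero_iff two_ne_zero |>.1 this)]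

lemma card_cyclicVertices (hd : 0 < d) (ht : StrictMono t) : (cyclicVertices d t).card = n := by
  rw [cyclicVertices, Finset.card_image_of_injective _
    (show Function.Injective fun i => momentCurve d (t i) from
      (momentCurve_injective hd).comp ht.injective)]
  simp

lemma vectorSpan_cyclicPolytope (hn : d + 1 ≤ n) (ht : StrictMono t) :
    vectorSpan ℝ (cyclicPolytope d t) = ⊤ := by
  rw [← direction_affineSpan, cyclicPolytope, affineSpan_convexHull, direction_affineSpan,
    ← Submodule.orthogonal_eq_bot_iff, Submodule.eq_bot_iff]
  intro v hv
  set p : ℝ[X] := ∑ i : Fin d, C (v i) * X ^ ((i : ℕ) + 1) with hp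
  have hdeg : p.natDegree ≤ d := natDegree_sum_le_of_forall_le _ _ fun i _ =>
    (natDegree_C_mul_X_pow_le _ _).trans (by omega)
  have hcoeff : ∀ j : Fin d, p.coeff ((j : ℕ) + 1) = v j := by
    intro j
    simp [hp, coeff_C_mul, coeff_X_pow, Fin.val_inj]
  have hvec : coeffVec d p = v := by
    ext j; simp [coeffVec, hcoeff]
  have h0 : 0 < n := by omega
  set q := p - C (p.eval (t ⟨0, h0⟩)) with hq
  have hq0 : q = 0 := by
    refine eq_zero_of_natDegree_lt_card_of_eval_eq_zero q ht.injective (fun i => ?_) ?_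
    · have := (Submodule.mem_orthogonal _ _).1 hv _
        (vsub_mem_vectorSpan ℝ (Set.mem_range_self i) (Set.mem_range_self (⟨0, h0⟩ : Fin n)))
      rw [real_inner_comm, ← hvec, vsub_eq_sub, inner_sub_right, inner_coeffVec_momentCurve hdeg,
        inner_coeffVec_momentCurve hdeg] at this
      simp only [hq, eval_sub, eval_C]
      linarith
    · rw [hq, natDegree_sub_C, Fintype.card_fin]; omega
  ext j
  rw [← hcoeff j, show p = C (p.eval (t ⟨0, h0⟩)) from sub_eq_zero.1 hq0, coeff_C_succ]
  rfl

lemma cyclicPolytope_mem_polytopes (hd : 2 ≤ d) (hn : d + 1 ≤ n) (ht : StrictMono t) :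
    cyclicPolytope d t ∈ polytopes d n := by
  refine ⟨⟨_, Set.finite_range _, rfl⟩, ?_, ?_⟩
  · rw [vectorSpan_cyclicPolytope hn ht, finrank_top, finrank_euclideanSpace_fin]
  · rw [extremePoints_cyclicPolytope hd, Set.encard_coe_eq_coe_finsetCard,
      card_cyclicVertices (by omega) ht]

/-- A polynomial `q` changing sign between two sets of parameters and, for each pair of
parameters from the two sets, a polynomial supporting the corresponding edge, bound `ν` from
below. -/
lemma card_mul_card_le_nu (hd : 0 < d) (ht : StrictMono t) {q : ℝ[X]} (hq : q.natDegree ≤ d) {c : ℝ}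
    (I J : Finset (Fin n)) (hI : ∀ i ∈ I, c < q.eval (t i)) (hJ : ∀ j ∈ J, q.eval (t j) < c)
    (hI0 : I.Nonempty) (hJ0 : J.Nonempty)
    (hedge : ∀ i ∈ I, ∀ j ∈ J, ∃ p : ℝ[X], p.natDegree ≤ d ∧ (∀ k, 0 ≤ p.eval (t k)) ∧
      ∀ k, p.eval (t k) = 0 ↔ k = i ∨ k = j) :
    ((I.card * J.card : ℕ) : ℕ∞) ≤ nu (cyclicPolytope d t) := by
  classical
  set φ := innerₗ (EuclideanSpace ℝ (Fin d)) (coeffVec d q) with hφ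
  have hφt : ∀ i, φ (momentCurve d (t i)) = q.eval (t i) - q.coeff 0 := fun i => by
    rw [hφ, innerₗ_apply_apply, inner_coeffVec_momentCurve hq]
  have hinj : Function.Injective fun i => momentCurve d (t i) :=
    (momentCurve_injective hd).comp ht.injective
  set A := I.image fun i => momentCurve d (t i)
  set B := J.image fun i => momentCurve d (t i)
  have hA : ∀ a ∈ A, c - q.coeff 0 < φ a := by
    intro a ha
    obtain ⟨i, hi, rfl⟩ := Finset.mem_image.1 ha
    rw [hφt]; linarith [hI i hi]
  have hB : ∀ a ∈ B, φ a < c - q.coeff 0 := by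
    intro a ha
    obtain ⟨i, hi, rfl⟩ := Finset.mem_image.1 ha
    rw [hφt]; linarith [hJ i hi]
  have hAS : A ⊆ cyclicVertices d t := Finset.image_subset_image (Finset.subset_univ _)
  have hBS : B ⊆ cyclicVertices d t := Finset.image_subset_image (Finset.subset_univ _)
  have key := card_mul_card_le_encard_extremePoints (S := cyclicVertices d t) A B hAS hBS hA hB (by
    intro a ha b hb
    obtain ⟨i, hi, rfl⟩ := Finset.mem_image.1 ha
    obtain ⟨j, hj, rfl⟩ := Finset.mem_image.1 hb
    obtain ⟨p, hp, hp0, hpz⟩ := hedge i hi j hj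
    obtain ⟨f, κ, h1, h2⟩ := exists_supporting_functional hp hp0
    refine ⟨f, κ, h1, (h2 _).2 ((hpz i).2 (Or.inl rfl)), (h2 _).2 ((hpz j).2 (Or.inr rfl)), ?_⟩
    intro v hv hvκ
    obtain ⟨k, -, rfl⟩ := Finset.mem_image.1 hv
    rcases (hpz k).1 ((h2 _).1 hvκ) with h | h
    · exact Or.inl (by rw [h])
    · exact Or.inr (by rw [h]))
  rw [Finset.card_image_of_injective _ hinj, Finset.card_image_of_injective _ hinj,
    ← cyclicPolytope_eq] at key
  refine key.trans (le_sSup ⟨{y | φ y = c - q.coeff 0}, ⟨⟨coeffVec d q, _, ?_, rfl⟩, ?_⟩, rfl⟩)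
  · intro h0
    obtain ⟨i, hi⟩ := hI0
    obtain ⟨j, hj⟩ := hJ0
    have h1 := hA _ (Finset.mem_image_of_mem _ hi)
    have h2 := hB _ (Finset.mem_image_of_mem _ hj)
    simp only [hφ, h0, map_zero, LinearMap.zero_apply] at h1 h2
    linarith
  · obtain ⟨i, hi⟩ := hI0
    obtain ⟨j, hj⟩ := hJ0
    have h1 := Finset.mem_image_of_mem (fun i => momentCurve d (t i)) hi
    have h2 := Finset.mem_image_of_mem (fun i => momentCurve d (t i)) hj
    obtain ⟨x, hx, hxc⟩ := exists_mem_openSegment_of_lt (hA _ h1) (hB _ h2)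
    refine ⟨x, hxc, ?_⟩
    rw [cyclicPolytope_eq]
    exact (convex_convexHull ℝ _).openSegment_subset (subset_convexHull ℝ _ (hAS h1))
      (subset_convexHull ℝ _ (hBS h2)) hx

/-- Cyclic polytopes of dimension at least four are neighbourly: all pairs of vertices are edges,
and a hyperplane halving the vertices crosses `⌊n/2⌋⌈n/2⌉` of them. -/
lemma le_nu_cyclicPolytope (hd : 4 ≤ d) (hn : 2 ≤ n) (ht : StrictMono t) :
    ((n / 2 * (n - n / 2) : ℕ) : ℕ∞) ≤ nu (cyclicPolytope d t) := by
  have h1 : n / 2 < n := by omega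
  have h2 : n / 2 - 1 < n := by omega
  set m : Fin n := ⟨n / 2, h1⟩ with hm
  set m' : Fin n := ⟨n / 2 - 1, h2⟩ with hm'
  have hmm : t m' < t m := ht (by simp only [hm, hm', Fin.mk_lt_mk]; omega)
  have key := card_mul_card_le_nu (d := d) (t := t) (q := X) (c := (t m' + t m) / 2) (by omega) ht
    (by rw [natDegree_X]; omega) (Finset.Ici m) (Finset.Iio m) (fun i hi => by
      have := ht.monotone (Finset.mem_Ici.1 hi)
      rw [eval_X]; linarith) (fun i hi => by
      have : t i ≤ t m' := ht.monotone (by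
        have := Finset.mem_Iio.1 hi
        simp only [hm, hm', Fin.lt_def, Fin.le_def] at this ⊢
        omega)
      rw [eval_X]; linarith) ⟨m, by simp⟩ ⟨m', by
        rw [Finset.mem_Iio]
        simp only [hm, hm', Fin.mk_lt_mk]; omega⟩ (fun i _ j _ => by
      refine ⟨(X - C (t i)) ^ 2 * (X - C (t j)) ^ 2, ?_, fun k => ?_, fun k => ?_⟩
      · refine natDegree_mul_le.trans ?_
        rw [natDegree_pow, natDegree_pow, natDegree_X_sub_C, natDegree_X_sub_C]
        omega
      · simp only [eval_mul, eval_pow, eval_sub, eval_X, eval_C]; positivity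
      · simp [sub_eq_zero, ht.injective.eq_iff])
  rw [Fin.card_Ici, Fin.card_Iio, mul_comm] at key
  exact key

/-- In dimension three, the first and the last vertex of a cyclic polytope are joined by edges to
all others, and a plane separates these two from the rest. -/
lemma le_nu_cyclicPolytope_three (hn : 3 ≤ n) (ht : StrictMono t) :
    ((2 * (n - 2) : ℕ) : ℕ∞) ≤ nu (cyclicPolytope 3 t) := by
  classical
  set o : Fin n := ⟨0, by omega⟩ with ho
  set l : Fin n := ⟨n - 1, by omega⟩ with hl
  have hol : o ≠ l := by simp only [ho, hl, ne_eq, Fin.mk.injEq]; omega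
  have hole : ∀ i, o ≤ i := fun i => by simp [ho, Fin.le_def]
  have hlle : ∀ i, i ≤ l := fun i => by simp only [hl, Fin.le_def]; omega
  have hneg : ∀ i, i ∉ ({o, l} : Finset (Fin n)) → (t i - t o) * (t i - t l) < 0 := by
    intro i hi
    simp only [Finset.mem_insert, Finset.mem_singleton, not_or] at hi
    exact mul_neg_of_pos_of_neg (sub_pos.2 (ht (lt_of_le_of_ne (hole i) (Ne.symm hi.1))))
      (sub_neg.2 (ht (lt_of_le_of_ne (hlle i) hi.2)))
  obtain ⟨c, hc, hc0⟩ : ∃ c : ℝ, (∀ i, i ∉ ({o, l} : Finset (Fin n)) →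
      (t i - t o) * (t i - t l) < c) ∧ c < 0 := by
    have h1 : ∀ᶠ c in nhdsWithin (0 : ℝ) (Set.Iio 0), ∀ i, i ∉ ({o, l} : Finset (Fin n)) →
        (t i - t o) * (t i - t l) < c := by
      rw [Filter.eventually_all]
      intro i
      by_cases hi : i ∈ ({o, l} : Finset (Fin n))
      · exact Filter.Eventually.of_forall fun c h => absurd hi h
      · filter_upwards [Ioo_mem_nhdsLT (hneg i hi)] with c hc _
        exact hc.1
    exact (h1.and self_mem_nhdsWithin).exists
  have hcard : (({o, l} : Finset (Fin n))ᶜ).card = n - 2 := by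
    rw [Finset.card_compl, Finset.card_pair hol, Fintype.card_fin]
  have key := card_mul_card_le_nu (d := 3) (t := t) (q := (X - C (t o)) * (X - C (t l))) (c := c)
    (by omega) ht (by
      refine natDegree_mul_le.trans ?_
      rw [natDegree_X_sub_C, natDegree_X_sub_C]; omega) {o, l} {o, l}ᶜ (fun i hi => by
      simp only [Finset.mem_insert, Finset.mem_singleton] at hi
      simp only [eval_mul, eval_sub, eval_X, eval_C]
      rcases hi with rfl | rfl <;> simpa using hc0) (fun i hi => by
      simp only [eval_mul, eval_sub, eval_X, eval_C]
      exact hc i (Finset.mem_compl.1 hi)) ⟨o, by simp⟩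
      (Finset.card_pos.1 (by rw [hcard]; omega)) (fun i hi j _ => by
      simp only [Finset.mem_insert, Finset.mem_singleton] at hi
      have hdeg : ((X - C (t i)) * (X - C (t j)) ^ 2).natDegree ≤ 3 := by
        refine natDegree_mul_le.trans ?_
        rw [natDegree_pow, natDegree_X_sub_C, natDegree_X_sub_C]
      rcases hi with rfl | rfl
      · refine ⟨(X - C (t o)) * (X - C (t j)) ^ 2, hdeg, fun k => ?_, fun k => ?_⟩
        · have := sub_nonneg.2 (ht.monotone (hole k))
          simp only [eval_mul, eval_pow, eval_sub, eval_X, eval_C]; positivity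
        · simp [sub_eq_zero, ht.injective.eq_iff]
      · refine ⟨-((X - C (t l)) * (X - C (t j)) ^ 2), by rwa [natDegree_neg],
          fun k => ?_, fun k => ?_⟩
        · have := sub_nonneg.2 (ht.monotone (hlle k))
          simp only [eval_neg, eval_mul, eval_pow, eval_sub, eval_X, eval_C]
          rw [← neg_mul, neg_sub]; positivity
        · simp [sub_eq_zero, ht.injective.eq_iff])
  rwa [hcard, Finset.card_pair hol] at key

end Cyclic

/-! ### Counting -/

section UpperBound

variable {d n : ℕ} {P : Set (EuclideanSpace ℝ (Fin d))}

lemma exists_eq_convexHull_of_mem_polytopes (hP : P ∈ polytopes d n) :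
    ∃ V : Finset (EuclideanSpace ℝ (Fin d)), P = convexHull ℝ (V : Set (EuclideanSpace ℝ (Fin d))) ∧
      vertexSet P = V ∧ V.card = n := by
  obtain ⟨⟨S, hS, hPS⟩, -, hcard⟩ := hP
  have hfin : (vertexSet P).Finite :=
    Set.finite_of_encard_eq_coe hcard
  refine ⟨hfin.toFinset, ?_, by simp, ?_⟩
  · rw [Set.Finite.coe_toFinset]
    have h := closure_convexHull_extremePoints (s := P)
      (by rw [hPS]; exact hS.isCompact_convexHull ℝ) (by rw [hPS]; exact convex_convexHull ℝ S)
    exact h.symm.trans (hfin.isClosed_convexHull ℝ).closure_eq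
  · rw [hfin.encard_eq_coe_toFinset_card] at hcard
    exact_mod_cast hcard

lemma exists_inner_ne (hP : P ∈ polytopes d n) {V : Finset (EuclideanSpace ℝ (Fin d))}
    (hV : P = convexHull ℝ (V : Set (EuclideanSpace ℝ (Fin d)))) {a : EuclideanSpace ℝ (Fin d)}
    (ha : a ≠ 0) (b : ℝ) : ∃ v ∈ V, inner ℝ a v ≠ b := by
  by_contra hcon
  push Not at hcon
  have htop : vectorSpan ℝ P = ⊤ :=
    Submodule.eq_top_of_finrank_eq (by rw [hP.2.1, finrank_euclideanSpace_fin])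
  have hsub : ∀ x ∈ P, inner ℝ a x = b := by
    rw [hV]
    exact fun x hx => convexHull_min (t := {x | innerₗ _ a x = b}) hcon
      (convex_hyperplane (innerₗ _ a).isLinear b) hx
  have hle : vectorSpan ℝ P ≤ LinearMap.ker (innerₗ (EuclideanSpace ℝ (Fin d)) a) := by
    rw [vectorSpan, Submodule.span_le]
    rintro _ ⟨x, hx, y, hy, rfl⟩
    simp [inner_sub_right, hsub x hx, hsub y hy]
  have hmem : a ∈ LinearMap.ker (innerₗ (EuclideanSpace ℝ (Fin d)) a) := by
    apply hle; rw [htop]; trivial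
  exact ha (inner_self_eq_zero.1 (LinearMap.mem_ker.1 hmem))

/-- Two coordinates complement a nonzero functional on three-dimensional space. -/
lemma exists_coordinates {a : EuclideanSpace ℝ (Fin 3)} (ha : a ≠ 0) :
    ∃ g₁ g₂ : EuclideanSpace ℝ (Fin 3) →ₗ[ℝ] ℝ,
      ∀ v, innerₗ _ a v = 0 → g₁ v = 0 → g₂ v = 0 → v = 0 := by
  obtain ⟨i, hi⟩ : ∃ i, a i ≠ 0 := by
    by_contra hcon
    push Not at hcon
    exact ha (by ext i; exact hcon i)
  refine ⟨(EuclideanSpace.proj (i + 1) : EuclideanSpace ℝ (Fin 3) →L[ℝ] ℝ).toLinearMap,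
    (EuclideanSpace.proj (i + 2) : EuclideanSpace ℝ (Fin 3) →L[ℝ] ℝ).toLinearMap,
    fun v h0 h1 h2 => ?_⟩
  rw [innerₗ_apply_apply, PiLp.inner_apply, Fin.sum_univ_three] at h0
  ext j
  fin_cases i <;> fin_cases j <;> simp_all

lemma floor_mul_ceil (n : ℕ) : ⌊(n : ℝ) / 2⌋₊ * ⌈(n : ℝ) / 2⌉₊ = n / 2 * (n - n / 2) := by
  have h1 : ⌊(n : ℝ) / 2⌋₊ = n / 2 := by
    simpa using Nat.floor_div_eq_div (K := ℝ) n 2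
  have h2 : ⌈(n : ℝ) / 2⌉₊ = n - n / 2 := by
    rcases Nat.even_or_odd' n with ⟨k, rfl | rfl⟩
    · rw [show ((2 * k : ℕ) : ℝ) / 2 = k by push_cast; ring, Nat.ceil_natCast]; omega
    · rw [show 2 * k + 1 - (2 * k + 1) / 2 = k + 1 by omega, Nat.ceil_eq_iff (by omega)]
      push_cast
      constructor <;> linarith
  rw [h1, h2]

lemma maxSliceVertices_eq (hd : d ≠ 3) : maxSliceVertices d n = n / 2 * (n - n / 2) := by
  rw [maxSliceVertices, if_neg hd, floor_mul_ceil]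

lemma add_mul_le {k p q n : ℕ} (hn : 4 ≤ n) (hkpq : k + p + q = n) (hk : k < n) :
    k + p * q ≤ n / 2 * (n - n / 2) := by
  have hhalf : ∀ r s, r + s = n → r * s ≤ n / 2 * (n - n / 2) := by
    intro r s hrs
    obtain ⟨m, hm | hm⟩ := Nat.even_or_odd' n
    · rw [hm, show 2 * m / 2 = m by omega, show 2 * m - m = m by omega]
      zify at *
      nlinarith [sq_nonneg ((r : ℤ) - s)]
    · rw [hm, show (2 * m + 1) / 2 = m by omega, show 2 * m + 1 - m = m + 1 by omega]
      rcases le_total r m with h | h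
      · obtain ⟨e, rfl⟩ := Nat.exists_eq_add_of_le h
        obtain rfl : s = r + e + e + 1 := by omega
        nlinarith
      · rcases h.eq_or_lt with h | h
        · subst h
          obtain rfl : s = m + 1 := by omega
          rfl
        · obtain ⟨e, rfl⟩ := Nat.exists_eq_add_of_lt h
          obtain ⟨e', rfl⟩ : ∃ e', m = s + e' := ⟨m - s, by omega⟩
          obtain rfl : e = e' := by omega
          nlinarith
  rcases Nat.eq_zero_or_pos p with rfl | hp
  · have := hhalf 2 (n - 2) (by omega)
    omega
  rcases Nat.eq_zero_or_pos q with rfl | hq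
  · have := hhalf 2 (n - 2) (by omega)
    omega
  have := hhalf (p + k) q (by omega)
  nlinarith

/-- Every slice has at most `maxSliceVertices d n` vertices: with `k`, `p`, `q` vertices of the
polytope on, above and below the hyperplane there are at most `k` vertices of the first kind, and
the others are determined by the two endpoints of an edge. -/
lemma encard_extremePoints_slice_le (hd : 3 ≤ d) (hn : d + 1 ≤ n) (hP : P ∈ polytopes d n)
    {a : EuclideanSpace ℝ (Fin d)} (ha : a ≠ 0) (c : ℝ) :
    (({x | inner ℝ a x = c} ∩ P).extremePoints ℝ).encard ≤ maxSliceVertices d n := by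
  classical
  obtain ⟨V, hPV, hvert, hcard⟩ := exists_eq_convexHull_of_mem_polytopes hP
  obtain ⟨v₀, hv₀, hv₀c⟩ := exists_inner_ne hP hPV ha c
  set φ := innerₗ (EuclideanSpace ℝ (Fin d)) a with hφ
  change (({x | φ x = c} ∩ P).extremePoints ℝ).encard ≤ _
  change φ v₀ ≠ c at hv₀c
  set K := V.filter fun v => φ v = c with hK
  set A := V.filter fun v => c < φ v with hA
  set B := V.filter fun v => φ v < c with hB
  have hKV : K.card < n := by
    rw [← hcard]
    exact Finset.card_lt_card (Finset.filter_ssubset.2 ⟨v₀, hv₀, hv₀c⟩)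
  have hsum : K.card + A.card + B.card = n := by
    rw [← hcard, ← Finset.card_filter_add_card_filter_not (s := V) (fun v => φ v = c), add_assoc,
      ← Finset.card_union_of_disjoint]
    · congr 2
      ext v
      simp only [hA, hB, Finset.mem_union, Finset.mem_filter, ← and_or_left]
      exact and_congr_right fun _ => ⟨fun h => h.elim (fun h => h.ne') fun h => h.ne,
        fun h => (lt_or_gt_of_ne h).symm⟩
    · rw [Finset.disjoint_left]
      intro v h1 h2
      exact absurd (Finset.mem_filter.1 h1).2 (Finset.mem_filter.1 h2).2.not_gt
  set X := ({x | φ x = c} ∩ P).extremePoints ℝ with hX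
  have hex : ∀ x, ∃ q : EuclideanSpace ℝ (Fin d) × EuclideanSpace ℝ (Fin d), x ∈ X \ V →
      q.1 ∈ A ∧ q.2 ∈ B ∧ x ∈ openSegment ℝ q.1 q.2 := by
    intro x
    by_cases hx : x ∈ X \ (V : Set (EuclideanSpace ℝ (Fin d)))
    · rcases mem_or_exists_openSegment_of_mem_extremePoints V (by rw [← hPV]; exact hx.1) with h | h
      · exact absurd h hx.2
      · obtain ⟨p, hp, q, hq, h1, h2, h3⟩ := h
        exact ⟨(p, q), fun _ => ⟨Finset.mem_filter.2 ⟨hp, h1⟩, Finset.mem_filter.2 ⟨hq, h2⟩, h3⟩⟩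
    · exact ⟨(x, x), fun h => absurd h hx⟩
  choose e he using hex
  have hmaps : Set.MapsTo e (X \ V) (A ×ˢ B : Finset _) := fun x hx =>
    Finset.mem_coe.2 (Finset.mem_product.2 ⟨(he x hx).1, (he x hx).2.1⟩)
  have hinj : Set.InjOn e (X \ V) := by
    intro x hx y hy hxy
    obtain ⟨h1, h2, h3⟩ := he x hx
    obtain ⟨-, -, h6⟩ := he y hy
    rw [← hxy] at h6
    exact eq_of_mem_openSegment
      ((Finset.mem_filter.1 h2).2.trans (Finset.mem_filter.1 h1).2).ne' h3 h6
      ((show φ x = c from hx.1.1.1).trans (show φ y = c from hy.1.1.1).symm)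
  have hle := Set.encard_le_encard_of_injOn hmaps hinj
  rw [Set.encard_coe_eq_coe_finsetCard, Finset.card_product] at hle
  have hfin : (X \ (V : Set (EuclideanSpace ℝ (Fin d)))).Finite := Set.finite_of_encard_le_coe hle
  set Y := hfin.toFinset with hY
  have hYmem : ∀ x, x ∈ Y ↔ x ∈ X \ (V : Set (EuclideanSpace ℝ (Fin d))) := fun x => by simp [hY]
  have hYle : Y.card ≤ A.card * B.card := by
    rw [hfin.encard_eq_coe_toFinset_card] at hle
    exact_mod_cast hle
  have hXle : X.encard ≤ ((K.card + Y.card : ℕ) : ℕ∞) := by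
    calc X.encard ≤ ((K ∪ Y : Finset _) : Set (EuclideanSpace ℝ (Fin d))).encard := by
          apply Set.encard_le_encard
          intro x hx
          simp only [Finset.coe_union, Set.mem_union, Finset.mem_coe]
          by_cases hxV : x ∈ V
          · exact Or.inl (Finset.mem_filter.2 ⟨hxV, hx.1.1⟩)
          · exact Or.inr ((hYmem x).2 ⟨hx, hxV⟩)
      _ ≤ _ := by
          rw [Set.encard_coe_eq_coe_finsetCard]
          exact_mod_cast Finset.card_union_le _ _
  refine hXle.trans (Nat.cast_le.2 ?_)
  by_cases h3 : d = 3
  · subst h3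
    rw [maxSliceVertices, if_pos rfl]
    by_cases hY2 : 2 ≤ Y.card
    · obtain ⟨g₁, g₂, hg⟩ := exists_coordinates ha
      have hVext : ∀ v ∈ V, v ∈ P.extremePoints ℝ := fun v hv => by
        have h := hvert
        rw [vertexSet] at h
        rw [h]; exact hv
      have hpl := card_le_of_planar_slice (c := c) hg (by rw [hPV]; exact convex_convexHull ℝ _)
        A B Y (fun v hv => ⟨hVext v (Finset.mem_filter.1 hv).1, (Finset.mem_filter.1 hv).2⟩)
        (fun v hv => ⟨hVext v (Finset.mem_filter.1 hv).1, (Finset.mem_filter.1 hv).2⟩)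
        (fun x hx => ((hYmem x).1 hx).1) (fun x => (e x).1) (fun x => (e x).2)
        (fun x hx => (he x ((hYmem x).1 hx)).1) (fun x hx => (he x ((hYmem x).1 hx)).2.1)
        (fun x hx => (he x ((hYmem x).1 hx)).2.2) hY2
      have hA0 : 0 < A.card := by
        by_contra h
        rw [show A.card = 0 by omega] at hYle
        omega
      have hB0 : 0 < B.card := by
        by_contra h
        rw [show B.card = 0 by omega] at hYle
        omega
      omega
    · -- at most one vertex off `V`; if there is one, both sides contain a vertex
      have hY1 : Y.card = 0 ∨ (0 < A.card ∧ 0 < B.card) := by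
        rcases Nat.eq_zero_or_pos Y.card with h | h
        · exact Or.inl h
        · exact Or.inr (CanonicallyOrderedAdd.mul_pos.1 (h.trans_le hYle))
      omega
  · rw [maxSliceVertices_eq h3]
    exact (Nat.add_le_add_left hYle _).trans (add_mul_le (by omega) hsum hKV)

lemma nu_le_maxSliceVertices (hd : 3 ≤ d) (hn : d + 1 ≤ n) (hP : P ∈ polytopes d n) :
    nu P ≤ maxSliceVertices d n := by
  apply sSup_le
  rintro _ ⟨_, ⟨⟨a, b, ha, rfl⟩, -⟩, rfl⟩
  exact encard_extremePoints_slice_le hd hn hP ha b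

lemma isGreatest_nu (hd : 3 ≤ d) (hn : d + 1 ≤ n) (hP : P ∈ polytopes d n) :
    IsGreatest (sliceVertexCount P '' slicingHyperplanes P) (nu P) := by
  refine ⟨Set.Nonempty.csSup_mem ?_ ?_, fun x hx => le_sSup hx⟩
  · obtain ⟨V, hPV, -, hcard⟩ := exists_eq_convexHull_of_mem_polytopes hP
    obtain ⟨v, hv⟩ : V.Nonempty := Finset.card_pos.1 (by omega)
    set a : EuclideanSpace ℝ (Fin d) := EuclideanSpace.single ⟨0, by omega⟩ 1
    refine ⟨_, {x | inner ℝ a x = inner ℝ a v}, ⟨⟨a, _, ?_, rfl⟩, v, rfl, ?_⟩, rfl⟩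
    · simp [a]
    · rw [hPV]; exact subset_convexHull ℝ _ hv
  · refine ((Set.finite_Iic (maxSliceVertices d n)).image (Nat.cast : ℕ → ℕ∞)).subset ?_
    rintro x hx
    obtain ⟨m, rfl, hm⟩ := ENat.le_natCast_iff.1
      ((le_sSup hx : x ≤ nu P).trans (nu_le_maxSliceVertices hd hn hP))
    exact ⟨m, hm, rfl⟩

lemma nu_cyclicPolytope (hd : 3 ≤ d) (hn : d + 1 ≤ n) {t : Fin n → ℝ} (ht : StrictMono t) :
    nu (cyclicPolytope d t) = maxSliceVertices d n := by
  apply le_antisymm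
    (nu_le_maxSliceVertices hd hn (cyclicPolytope_mem_polytopes (by omega) hn ht))
  by_cases h3 : d = 3
  · subst h3
    rw [maxSliceVertices, if_pos rfl]
    exact le_nu_cyclicPolytope_three (by omega) ht
  · rw [maxSliceVertices_eq h3]
    exact le_nu_cyclicPolytope (by omega) (by omega) ht

end UpperBound

end PolytopeSlice

theorem theorem1 (d n : ℕ) (hd : 3 ≤ d) (hn : d + 1 ≤ n) :
    -- for each `d`-polytope with `n` vertices, `ν(P)` is an actual maximum
    (∀ P ∈ PolytopeSlice.polytopes d n,
      IsGreatest (PolytopeSlice.sliceVertexCount P '' PolytopeSlice.slicingHyperplanes P)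
        (PolytopeSlice.nu P)) ∧
    -- the maximum of `ν` over all `d`-polytopes with `n` vertices
    IsGreatest (PolytopeSlice.nu '' PolytopeSlice.polytopes d n)
      (PolytopeSlice.maxSliceVertices d n : ℕ∞) ∧
    -- it is attained by every cyclic `d`-polytope with `n` vertices
    (∀ t : Fin n → ℝ, StrictMono t →
      PolytopeSlice.cyclicPolytope d t ∈ PolytopeSlice.polytopes d n ∧
      PolytopeSlice.nu (PolytopeSlice.cyclicPolytope d t) =
        (PolytopeSlice.maxSliceVertices d n : ℕ∞)) := by
  have hcyc : ∀ t : Fin n → ℝ, StrictMono t →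
      PolytopeSlice.cyclicPolytope d t ∈ PolytopeSlice.polytopes d n ∧
      PolytopeSlice.nu (PolytopeSlice.cyclicPolytope d t) =
        (PolytopeSlice.maxSliceVertices d n : ℕ∞) := fun t ht =>
    ⟨PolytopeSlice.cyclicPolytope_mem_polytopes (by omega) hn ht,
      PolytopeSlice.nu_cyclicPolytope hd hn ht⟩
  refine ⟨fun P hP => PolytopeSlice.isGreatest_nu hd hn hP, ⟨?_, ?_⟩, hcyc⟩
  · obtain ⟨h1, h2⟩ := hcyc (fun i => (i : ℝ)) (fun i j hij => by simpa using hij)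
    exact ⟨_, h1, h2⟩
  · rintro _ ⟨P, hP, rfl⟩
    exact PolytopeSlice.nu_le_maxSliceVertices hd hn hP
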